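/- **Conventions.** $\Delta$ is a simplicial complex on a finite base set $S$ (down-closed, containing $\emptyset$ and every singleton $\{s\}$, $s\in S$), ordered by inclusion. A *$\Delta$-building set* is a set $B\subseteq\Delta\setminus\{\emptyset\}$ such that for every nonempty $X\in\Delta$, if $X_1,\dots,X_k$ are the maximal elements of $\{Y\in B: Y\subseteq X\}$, there is a poset isomorphism $\prod_{j}[\emptyset,X_j]\to[\emptyset,X]$ sending $(\emptyset,\dots,X_j,\dots,\emptyset)$ to $X_j$ for each $j$ (equivalently: $\{s\}\in B$ for all $s\in S$, and $I\cup J\in B$ whenever $I,J\in B$, $I\cap J\neq\emptyset$ and $I\cup J\in\Delta$). For $B\subseteq\Delta$, a set $N\subseteq B$ is *$B$-nested* if for every set $A\subseteq N$ of at least two pairwise incomparable faces, $\bigcup A\in\Delta$ and $\bigcup A\notin B$; the nested sets form the *nested complex* of $B$. Let $V=(v_s)_{s\in S}$ be vectors in a real vector space, and put $C_I=\operatorname{Cone}\{v_s: s\in I\}$. The cone complex $\mathcal F(\Delta,V)=\{C_I: I\in\Delta\}$ is *non-degenerate* if $C_I\cap C_J=C_{I\cap J}$ and $\dim C_I=|I|$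 for all $I,J\in\Delta$. For a nested set $N$ let $Q(N)$ be the preorder on $S\cup\{\infty\}$ with $i\preceq j$ iff every set in $N$ containing $j$ contains $i$. A *contraction* of a preorder $Q$ is the transitive closure of $Q\cup R^{\mathrm{op}}$ for some relation $R\subseteq Q$; a *ray contraction* is a contraction having exactly two equivalence classes, one strictly below the other. Let $K_N$ be the conic hull of the vectors $\sum_{i\prec_R\infty}v_i$, where $R$ ranges over the ray contractions of $Q(N)$, and let $\mathcal F(\Delta,V,B)=\{K_N: N \text{ is } B\text{-nested}\}$. For $I\in B$ let $B_I$ consist of $I$ and all singletons. The *coarsest common refinement* of fans $(\mathcal F_j)_{j}$ is $\{\bigcap_j C_j: C_j\in\mathcal F_j\}$. A fan $\mathcal F$ *coarsens* $\mathcal G$ if every cone of $\mathcal G$ lies in a cone of $\mathcal F$ and every cone of $\mathcal F$ is a union of cones of $\mathcal G$. **Theorem.** (1) Suppose $\mathcal F(\Delta,V)$ is non-degenerate and $B$ is a $\Delta$-building set. Then * $\mathcal F(\Delta,V,B)$ is a fan (finitely many finitely generated cones, closed under taking faces, any two of them meeting in a common face); * if $S\neq\emptyset$, then $\mathcal F(\Delta,V,B)$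 is equal to the coarsest common refinement of the fans $\mathcal F(\Delta,V,B_I)$, $I\in B$; * $\mathcal F(\Delta,V,B)$ coarsens the barycentric subdivision $\mathcal F(\Delta,V,\Delta\setminus\{\emptyset\})$ of $\mathcal F(\Delta,V)$. (2) Let $P$ be a full-dimensional simple polyhedron (every nonempty face of codimension $k$ lies in exactly $k$ facets) with at least one facet, in a finite-dimensional real inner product space. For a set $I$ of facets let $F_I\subseteq P$ be their intersection, and let $\Delta(P)$ be the complex of all $I$ with $F_I\neq\emptyset$. For each facet $s$ let $v_s$ be an outer normal vector, i.e. $s$ is the set of maximizers of $\langle v_s,\cdot\rangle$ on $P$; put $v_I=\sum_{s\in I}v_s$. The inequality $\langle a,x\rangle\le b$ *truncates $P$ at the face $F$* if $\langle a,x\rangle>b$ on $F$, every face $G\not\subseteq F$ of $P$ meeting $F$ meets the hyperplane $\langle a,x\rangle=b$, and $\langle a,x\rangle<b$ on every face of $P$ disjoint from $F$. Let $B$ be a $\Delta(P)$-building set. Then for each $I\in B$ there is $b_I\in\mathbb R$ such that $\langle v_I,x\rangle\le b_I$ truncates $P$ at $F_I$. Moreover, for every choice of such $b_I$, with $P_I=P\cap\{x:\langle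 v_I,x\rangle\le b_I\}$, the Minkowski sum $\sum_{I\in B}P_I$ is a $P$-nestohedron of $B$, i.e. a full-dimensional simple polyhedron whose dual simplicial complex is isomorphic to the nested complex of $B$. -/

import Mathlib

open scoped Pointwise

noncomputable section

namespace NestedFan

/-! ### Building sets and nested sets of semilattices -/

section Order

variable {L : Type*} [PartialOrder L]

/-- The set of maximal elements of `{y ∈ B | y ≤ x}`. -/
def maxBelow (B : Set L) (x : L) : Set L :=
  {y | Maximal (fun z => z ∈ B ∧ z ≤ x) y}

/-- `B ⊆ L ∖ {⊥}` is a building set of the semilattice `L` if for every `x ≠ ⊥`, with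
`x₁, …, x_k` the maximal elements of `B` below `x`, there is an order isomorphism
`∏ⱼ [⊥, xⱼ] ≃ [⊥, x]` which sends `(⊥, …, xⱼ, …, ⊥)` to `xⱼ` for every `j`. -/
def IsBuildingSet [OrderBot L] (B : Set L) : Prop :=
  ⊥ ∉ B ∧ ∀ x : L, x ≠ ⊥ →
    ∃ φ : ((j : maxBelow B x) → Set.Iic (j : L)) ≃o Set.Iic x,
      ∀ (j : maxBelow B x) (f : (i : maxBelow B x) → Set.Iic (i : L)),
        f j = ⊤ → (∀ i, i ≠ j → f i = ⊥) → (φ f : L) = (j : L)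

/-- `N ⊆ B` is nested if the join of every set of at least two pairwise incomparable elements
of `N` exists and does not belong to `B`. -/
def IsNested (B N : Set L) : Prop :=
  N ⊆ B ∧ ∀ A ⊆ N, IsAntichain (· ≤ ·) A → A.Nontrivial → ∃ z, IsLUB A z ∧ z ∉ B

theorem IsNested.mono {B N N' : Set L} (h : IsNested B N) (hN : N' ⊆ N) : IsNested B N' :=
  ⟨hN.trans h.1, fun A hA => h.2 A (hA.trans hN)⟩

theorem isNested_singleton {B : Set L} {x : L} (hx : x ∈ B) : IsNested B {x} :=
  ⟨Set.singleton_subset_iff.2 hx, fun _ hA _ hnt =>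
    absurd hnt (Set.not_nontrivial_iff.2 (Set.subsingleton_singleton.anti hA))⟩

/-- The nested complex of `B`: the simplicial complex on the base set `B` whose (nonempty) faces
are the (nonempty) nested sets. -/
def nestedComplex (B : Set L) : AbstractSimplicialComplex B where
  faces := {N | N.Nonempty ∧ IsNested B (Subtype.val '' (N : Set B))}
  isRelLowerSet_faces := fun _ hN =>
    ⟨hN.1, fun _ hM hne => ⟨hne, hN.2.mono (Set.image_mono (Finset.coe_subset.2 hM))⟩⟩
  singleton_mem := fun v =>
    ⟨Finset.singleton_nonempty v, by simpa using isNested_singleton v.2⟩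

end Order

/-! ### Preposets -/

section Preposet

variable {α : Type*}

/-- The preposet `Q` is a contraction of the preposet `P`: for some relation `R ⊆ P`, `Q` is the
reflexive transitive closure of `P ∪ Rᵒᵖ`. -/
def IsContraction (Q P : α → α → Prop) : Prop :=
  ∃ R : α → α → Prop, (∀ x y, R x y → P x y) ∧
    ∀ x y, Q x y ↔ Relation.ReflTransGen (fun a b => P a b ∨ R b a) x y

/-- A ray preposet has exactly two equivalence classes, a lower class `A` and an upper class `Aᶜ`,
with every element of `A` strictly below every element of `Aᶜ`. -/
def IsRayPreposet (R : α → α → Prop) : Prop :=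
  ∃ A : Set α, A.Nonempty ∧ Aᶜ.Nonempty ∧ ∀ x y, R x y ↔ (x ∈ A ∨ y ∉ A)

end Preposet

section Fans

variable {S : Type*} {E : Type*} [AddCommGroup E] [Module ℝ E]

/-- The finite elements of a preposet on `S ∪ {∞}` (`∞` is `none`): those strictly below `∞`. -/
def finiteElements (Q : Option S → Option S → Prop) : Set S :=
  {i | Q (some i) none ∧ ¬ Q none (some i)}

/-- The `Δ`-braid cone of a facial preposet `Q`: the conic hull of the vectors
`∑_{i finite in R} v_i`, over the ray contractions `R` of `Q`.
(The only ray contraction of a ray preposet is that preposet itself.) -/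
def braidCone (v : S → E) (Q : Option S → Option S → Prop) : PointedCone ℝ E :=
  PointedCone.hull ℝ {w | ∃ R : Option S → Option S → Prop,
    IsRayPreposet R ∧ IsContraction R Q ∧ w = ∑ᶠ i ∈ finiteElements R, v i}

/-! ### Simplicial complexes and their cone complexes -/

/-- The faces of a simplicial complex, including the empty face (which Mathlib's
`AbstractSimplicialComplex` leaves out), ordered by inclusion. -/
abbrev Face (Δ : AbstractSimplicialComplex S) : Type _ :=
  {I : Finset S // I = ∅ ∨ I ∈ Δ.faces}

instance (Δ : AbstractSimplicialComplex S) : OrderBot (Face Δ) where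
  bot := ⟨∅, Or.inl rfl⟩
  bot_le I := Finset.empty_subset I.1

variable {Δ : AbstractSimplicialComplex S}

/-- The cone `C_I` spanned by the vectors `v_i`, `i ∈ I`. -/
def faceCone (v : S → E) (I : Set S) : PointedCone ℝ E :=
  PointedCone.hull ℝ (v '' I)

/-- The cone complex `{C_I | I ∈ Δ}` is non-degenerate: `C_I ∩ C_J = C_{I ∩ J}` for all faces, and
every `C_I` is `|I|`-dimensional. -/
def NonDegenerate (Δ : AbstractSimplicialComplex S) (v : S → E) : Prop :=
  (∀ I J : Face Δ, faceCone v (I.1 : Set S) ⊓ faceCone v (J.1 : Set S) =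
      faceCone v ((I.1 : Set S) ∩ (J.1 : Set S))) ∧
  ∀ I : Face Δ,
    Module.finrank ℝ (Submodule.span ℝ (faceCone v (I.1 : Set S) : Set E)) = I.1.card

/-- The facial preposet `Q(N)` on `S ∪ {∞}`: `i ≼ j` iff every set in `N` that contains `j` also
contains `i`. -/
def facialPreposet (N : Set (Face Δ)) (i j : Option S) : Prop :=
  ∀ I ∈ N, j ∈ some '' (I.1 : Set S) → i ∈ some '' (I.1 : Set S)

/-- The nested set fan `{K_N | N is B-nested}`. -/
def nestedFan (v : S → E) (B : Set (Face Δ)) : Set (PointedCone ℝ E) :=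
  {C | ∃ N : Set (Face Δ), IsNested B N ∧ C = braidCone v (facialPreposet N)}

/-- `B_I`, consisting of `I` and of all singletons. -/
def singleFaceSet (I : Face Δ) : Set (Face Δ) :=
  {J | J = I ∨ ∃ s : S, J.1 = {s}}

/-- The maximal building set: all nonempty faces. -/
def maximalBuildingSet (Δ : AbstractSimplicialComplex S) : Set (Face Δ) :=
  {I | I ≠ ⊥}

/-! ### Fans -/

/-- A fan: a finite collection of finitely generated cones that contains every face of each of its
members and in which any two members meet in a common face. -/
structure IsFan (F : Set (PointedCone ℝ E)) : Prop where
  finite : F.Finite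
  fg : ∀ C ∈ F, C.FG
  face_mem : ∀ C ∈ F, ∀ D : PointedCone ℝ E, D.IsFaceOf C → D ∈ F
  inf_isFaceOf : ∀ C ∈ F, ∀ D ∈ F, (C ⊓ D).IsFaceOf C

/-- The coarsest common refinement of a family of fans: all intersections of a choice of one cone
from each fan. -/
def coarsestCommonRefinement {ι : Type*} (F : ι → Set (PointedCone ℝ E)) :
    Set (PointedCone ℝ E) :=
  {C | ∃ c : ι → PointedCone ℝ E, (∀ i, c i ∈ F i) ∧ C = ⨅ i, c i}

/-- `F` coarsens `G`: every cone of `G` lies in a cone of `F`, and every cone of `F` is a union of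
cones of `G`. -/
def Coarsens (F G : Set (PointedCone ℝ E)) : Prop :=
  (∀ C ∈ G, ∃ D ∈ F, C ≤ D) ∧
  ∀ D ∈ F, ∃ T ⊆ G, (D : Set E) = ⋃ C ∈ T, (C : Set E)

end Fans

/-! ### Polyhedra -/

section Polyhedra

variable {E : Type*} [NormedAddCommGroup E] [InnerProductSpace ℝ E]

/-- A polyhedron: the solution set of finitely many non-strict linear inequalities. -/
def IsPolyhedron (P : Set E) : Prop :=
  ∃ A : Finset (E × ℝ), P = {x | ∀ p ∈ A, inner ℝ p.1 x ≤ p.2}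

/-- The set of points of `P` at which `x ↦ ⟪a, x⟫` attains its maximum over `P`. -/
def maxFace (P : Set E) (a : E) : Set E :=
  {x ∈ P | ∀ y ∈ P, inner ℝ a y ≤ inner ℝ a x}

/-- The facets of a full-dimensional polyhedron: its nonempty faces of codimension one. -/
def facets (P : Set E) : Set (Set E) :=
  {F | IsExposed ℝ P F ∧ F.Nonempty ∧
    Module.finrank ℝ (vectorSpan ℝ F) + 1 = Module.finrank ℝ E}

/-- A full-dimensional simple polyhedron: every (nonempty) face of codimension `k` lies in exactly
`k` facets. -/
def IsSimplePolyhedron (P : Set E) : Prop :=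
  IsPolyhedron P ∧ (interior P).Nonempty ∧
  ∀ F : Set E, IsExposed ℝ P F → F.Nonempty →
    ({G ∈ facets P | F ⊆ G}.encard + Module.finrank ℝ (vectorSpan ℝ F) : ℕ∞) =
      Module.finrank ℝ E

/-- The face `F_I`, the intersection of the facets in `I` (all of `P` if `I` is empty). -/
def facetInter (P : Set E) (I : Finset (facets P)) : Set E :=
  {x ∈ P | ∀ s ∈ I, x ∈ s.1}

/-- The dual simplicial complex of a simple polyhedron, on the set of its facets:
the (nonempty) sets `I` of facets with `F_I ≠ ∅`. -/
def dualComplex (P : Set E) : AbstractSimplicialComplex (facets P) where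
  faces := {I | I.Nonempty ∧ (facetInter P I).Nonempty}
  isRelLowerSet_faces := fun _ hI =>
    ⟨hI.1, fun _ hJ hne => ⟨hne, hI.2.mono fun _ hx => ⟨hx.1, fun s hs => hx.2 s (hJ hs)⟩⟩⟩
  singleton_mem := fun s => by
    refine ⟨Finset.singleton_nonempty s, ?_⟩
    obtain ⟨x, hx⟩ := s.2.2.1
    exact ⟨x, s.2.1.subset hx, by simpa using hx⟩

/-- The inequality `⟪a, x⟫ ≤ b` truncates `P` at the face `F`. -/
def Truncates (P F : Set E) (a : E) (b : ℝ) : Prop :=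
  (∀ x ∈ F, b < inner ℝ a x) ∧
  (∀ G : Set E, IsExposed ℝ P G → (G ∩ F).Nonempty → ¬ G ⊆ F → ∃ x ∈ G, inner ℝ a x = b) ∧
  ∀ G : Set E, IsExposed ℝ P G → G ∩ F = ∅ → ∀ x ∈ G, inner ℝ a x < b

/-- The part of `P` in the halfspace `⟪a, x⟫ ≤ b`. -/
def truncation (P : Set E) (a : E) (b : ℝ) : Set E :=
  {x ∈ P | inner ℝ a x ≤ b}

/-- `Q` is a nestohedron of `B`: a full-dimensional simple polyhedron whose dual simplicial complex
is isomorphic to the nested complex of `B`. -/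
def IsNestohedron {L : Type*} [PartialOrder L] (B : Set L) (Q : Set E) : Prop :=
  IsSimplePolyhedron Q ∧ ∃ e : B ≃ facets Q, ∀ N : Finset B,
    N ∈ (nestedComplex B).faces ↔ N.map e.toEmbedding ∈ (dualComplex Q).faces

end Polyhedra

end NestedFan

end

open NestedFan

namespace NestedFan

/-! ### Building sets as union-closed families; combinatorics of nested sets -/

section Combinatorics

variable {S : Type*} {Δ : AbstractSimplicialComplex S}

/-! A building set can be handled through unions of intersecting members
(`IsBuildingSet.isUnionClosed`). Everything then rests on `IsUnionClosed.exists_argmin`: given a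
nested set `N` and `A ∈ B`, some vertex of `A` lies in no member of `N` except those containing `A`.
Hence, if a point has nonnegative coefficients `a` supported on a nested set, the minimum of its
vertex coordinates over `A` is the sum of the `a J` with `A ≤ J`.

For the fan: these minima show that the coordinates determine the support of `a`
(`IsNestedCoeff.pos_iff`), and a greedy subtraction writes every coordinate vector supported on a
face in this form (`IsUnionClosed.exists_expand`). Non-degeneracy makes coordinates unique, so a
point lies in the cone of `N` iff its nested support is contained in `N`, and the fan axioms become
statements about supports. Inclusion of supports amounts to `Dominated`: no new positive coordinates
and, for each `I ∈ B` separately, minimizers over `I` stay minimizers. This condition splits over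
the members of `B`, which gives the common refinement, and weakens when `B` shrinks, which gives the
coarsening. `braidCone_facialPreposet` identifies the cones defined by ray contractions with those
spanned by nested sets.

For the polyhedra: over a nested set, the functionals `faceVec v J` attain their maxima
simultaneously on each truncation, hence on the Minkowski sum. Conversely, the members of `B` tight
at a point of the sum are nested (`isNested_tight`): if the join `z` of an antichain of them were in
`B`, the summand truncated at `z` would have a point on the face that was cut off. A functional
bounded above on the sum is a nonnegative combination over a nested set, so the inequalities indexed
by `B` cut out the sum (`truncationSum_eq_hPoly`). The vectors of a nested set are independent
(`linearIndepOn_faceVec`), so the sum is simple and its dual complex is the nested complex.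
Fourier–Motzkin elimination supplies the polyhedral facts, including Farkas' lemma and the
polyhedrality of Minkowski sums. -/

theorem Face.of_subset (X : Face Δ) {I : Finset S} (h : I ⊆ X.1) : I = ∅ ∨ I ∈ Δ.faces := by
  rcases I.eq_empty_or_nonempty with h0 | hne
  · exact Or.inl h0
  · rcases X.2 with hX | hX
    · exact Or.inl (Finset.subset_empty.1 (hX ▸ h))
    · exact Or.inr ((Δ.isRelLowerSet_faces hX).2 h hne)

theorem Face.nonempty_of_ne_bot {I : Face Δ} (h : I ≠ ⊥) : ∃ s, s ∈ I.1 := by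
  by_contra! hc
  exact h (Subtype.ext (Finset.eq_empty_of_forall_notMem hc))

/-- The face consisting of a single vertex. -/
def Face.single (Δ : AbstractSimplicialComplex S) (s : S) : Face Δ :=
  ⟨{s}, Or.inr (Δ.singleton_mem s)⟩

theorem Face.mem_single {s t : S} : t ∈ (Face.single Δ s).1 ↔ t = s := Finset.mem_singleton

theorem Face.single_le {s : S} {I : Face Δ} : Face.single Δ s ≤ I ↔ s ∈ I.1 :=
  Finset.singleton_subset_iff

theorem Face.single_ne_bot (s : S) : Face.single Δ s ≠ ⊥ := fun h =>
  Finset.singleton_ne_empty s (congrArg Subtype.val h)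

theorem Face.not_le_bot {I : Face Δ} {s : S} (hs : s ∈ I.1) : I ≠ ⊥ := by
  rintro rfl
  exact absurd hs (Finset.notMem_empty s)

open scoped Classical in
/-- Least upper bounds in the face poset are unions. -/
theorem Face.isLUB_iff {A : Set (Face Δ)} {z : Face Δ} :
    IsLUB A z ↔ ∀ s, s ∈ z.1 ↔ ∃ J ∈ A, s ∈ J.1 := by
  constructor
  · intro h s
    refine ⟨fun hs => ?_, fun ⟨J, hJ, hs⟩ => h.1 hJ hs⟩
    let U : Face Δ := ⟨z.1.filter fun s => ∃ J ∈ A, s ∈ J.1,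
      Face.of_subset z (Finset.filter_subset _ _)⟩
    have hU : U ∈ upperBounds A := fun J hJ t ht =>
      Finset.mem_filter.2 ⟨h.1 hJ ht, J, hJ, ht⟩
    exact (Finset.mem_filter.1 (h.2 hU hs)).2
  · intro h
    refine ⟨fun J hJ s hs => (h s).2 ⟨J, hJ, hs⟩, fun z' hz' s hs => ?_⟩
    obtain ⟨J, hJ, hsJ⟩ := (h s).1 hs
    exact hz' hJ hsJ

open scoped Classical in
theorem Face.exists_isLUB {A : Set (Face Δ)} {X : Face Δ} (h : ∀ J ∈ A, J ≤ X) :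
    ∃ z, IsLUB A z ∧ z ≤ X := by
  refine ⟨⟨X.1.filter fun s => ∃ J ∈ A, s ∈ J.1, Face.of_subset X (Finset.filter_subset _ _)⟩,
    Face.isLUB_iff.2 fun s => ⟨fun hs => (Finset.mem_filter.1 hs).2, fun ⟨J, hJ, hs⟩ =>
      Finset.mem_filter.2 ⟨h J hJ hs, J, hJ, hs⟩⟩, Finset.filter_subset _ _⟩

/-- The description of building sets by unions: all singletons belong to `B`, and the union of two
intersecting members of `B` is in `B` as soon as it is a face. -/
structure IsUnionClosed (B : Set (Face Δ)) : Prop where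
  bot_notMem : ⊥ ∉ B
  single_mem : ∀ s, Face.single Δ s ∈ B
  sup_mem : ∀ I ∈ B, ∀ J ∈ B, (∃ s, s ∈ I.1 ∧ s ∈ J.1) →
    ∀ K : Face Δ, (∀ s, s ∈ K.1 ↔ s ∈ I.1 ∨ s ∈ J.1) → K ∈ B

theorem IsUnionClosed.exists_mem {B : Set (Face Δ)} (hB : IsUnionClosed B) {I : Face Δ}
    (hI : I ∈ B) : ∃ s, s ∈ I.1 :=
  Face.nonempty_of_ne_bot fun h => hB.bot_notMem (h ▸ hI)

theorem exists_maxBelow_le [Finite S] {B : Set (Face Δ)} {x y : Face Δ} (hy : y ∈ B) (hyx : y ≤ x) :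
    ∃ j ∈ maxBelow B x, y ≤ j := by
  obtain ⟨j, hj, hm⟩ := (Set.toFinite {z | z ∈ B ∧ z ≤ x}).exists_le_maximal ⟨hy, hyx⟩
  exact ⟨j, hm, hj⟩

open scoped Classical in
-- In the product decomposition, the factors of two distinct maximal elements meet only in `⊥`. Two
-- intersecting members of `B` share a vertex, so they lie below the same maximal element, which is
-- then their union.
theorem IsBuildingSet.isUnionClosed [Finite S] {B : Set (Face Δ)} (hB : IsBuildingSet B) :
    IsUnionClosed B := by
  refine ⟨hB.1, fun s => ?_, fun I hI J hJ ⟨s, hsI, hsJ⟩ K hK => ?_⟩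
  · obtain ⟨φ, -⟩ := hB.2 _ (Face.single_ne_bot (Δ := Δ) s)
    rcases isEmpty_or_nonempty (maxBelow B (Face.single Δ s)) with he | ⟨⟨j, hj⟩⟩
    · exfalso
      have hss : Subsingleton (Set.Iic (Face.single Δ s)) := φ.symm.toEquiv.subsingleton
      have := hss.elim ⟨⊥, Set.mem_Iic.2 bot_le⟩ ⟨Face.single Δ s, Set.mem_Iic.2 le_rfl⟩
      exact Face.single_ne_bot (Δ := Δ) s (congrArg Subtype.val this).symm
    · obtain ⟨t, ht⟩ := Face.nonempty_of_ne_bot (I := j) fun h => hB.1 (h ▸ hj.1.1)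
      have hts : t = s := Face.mem_single.1 (hj.1.2 ht)
      have : j = Face.single Δ s := le_antisymm hj.1.2 (Face.single_le.2 (hts ▸ ht))
      exact this ▸ hj.1.1
  · have hK0 : K ≠ ⊥ := Face.not_le_bot ((hK s).2 (Or.inl hsI))
    obtain ⟨φ, hφ⟩ := hB.2 K hK0
    obtain ⟨i, hi, hIi⟩ := exists_maxBelow_le hI (x := K) fun t ht => (hK t).2 (Or.inl ht)
    obtain ⟨j, hj, hJj⟩ := exists_maxBelow_le hJ (x := K) fun t ht => (hK t).2 (Or.inr ht)
    have hij : i = j := by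
      by_contra hne
      let f : (k : maxBelow B K) → (k' : maxBelow B K) → Set.Iic (k' : Face Δ) :=
        fun k k' => if k' = k then ⊤ else ⊥
      have hf : ∀ k, (φ (f k) : Face Δ) = k := fun k =>
        hφ k (f k) (if_pos rfl) fun l hl => if_neg hl
      have hsK : Face.single Δ s ≤ K := Face.single_le.2 ((hK s).2 (Or.inl hsI))
      have hle : ∀ k : maxBelow B K, s ∈ (k : Face Δ).1 →
          φ.symm ⟨Face.single Δ s, hsK⟩ ≤ f k := by
        intro k hk
        rw [OrderIso.symm_apply_le]
        exact Subtype.coe_le_coe.1 ((hf k).symm ▸ Face.single_le.2 hk)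
      -- The coordinate at `i` vanishes by comparison with the factor of `j`, all other coordinates
      -- by comparison with the factor of `i`.
      have hbot : φ.symm ⟨Face.single Δ s, hsK⟩ ≤ ⊥ := by
        intro l
        by_cases hl : l = ⟨i, hi⟩
        · refine (hle ⟨j, hj⟩ (hJj hsJ) l).trans (if_neg ?_).le
          rw [hl]
          exact fun h => hne (congrArg Subtype.val h)
        · exact (hle ⟨i, hi⟩ (hIi hsI) l).trans (if_neg hl).le
      rw [OrderIso.symm_apply_le] at hbot
      have h1 : φ ⊥ ≤ ⟨⊥, Set.mem_Iic.2 bot_le⟩ := by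
        rw [← OrderIso.le_symm_apply]
        exact bot_le
      exact Face.single_ne_bot (Δ := Δ) s (le_bot_iff.1 (hbot.trans h1))
    subst hij
    have : K = i := le_antisymm (fun t ht => ((hK t).1 ht).elim (fun h => hIi h) fun h => hJj h)
      hi.1.2
    exact this ▸ hi.1.1

theorem isUnionClosed_singleFaceSet {I : Face Δ} (hI : I ≠ ⊥) :
    IsUnionClosed (singleFaceSet I) := by
  refine ⟨?_, fun s => Or.inr ⟨s, rfl⟩, ?_⟩
  · rintro (h | ⟨s, h⟩)
    · exact hI h.symm
    · exact Finset.singleton_ne_empty s h.symm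
  · have key : ∀ (J J' K : Face Δ), (∃ t, J'.1 = {t}) → (∃ s, s ∈ J.1 ∧ s ∈ J'.1) →
        (∀ s, s ∈ K.1 ↔ s ∈ J.1 ∨ s ∈ J'.1) → K = J := by
      rintro J J' K ⟨t, ht⟩ ⟨s, hs, hs'⟩ hK
      refine Subtype.ext (Finset.ext fun u => (hK u).trans ⟨?_, Or.inl⟩)
      rintro (h | h)
      · exact h
      · rw [ht, Finset.mem_singleton] at h hs'
        rwa [h, ← hs']
    rintro J hJ J' hJ' ⟨s, hs, hs'⟩ K hK
    rcases hJ' with rfl | h'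
    · rcases hJ with rfl | h
      · exact Or.inl (Subtype.ext (Finset.ext fun u => (hK u).trans (or_self_iff)))
      · exact Or.inl (key J' J K h ⟨s, hs', hs⟩ fun u => (hK u).trans or_comm)
    · rw [key J J' K h' ⟨s, hs, hs'⟩ hK]
      exact hJ

theorem isUnionClosed_maximalBuildingSet : IsUnionClosed (maximalBuildingSet Δ) :=
  ⟨fun h => h rfl, Face.single_ne_bot, fun _ _ _ _ ⟨s, hs, _⟩ _ hK =>
    Face.not_le_bot ((hK s).2 (Or.inl hs))⟩

open scoped Classical in
/-- The union of a member of `B` and finitely many members of `B` that meet it is in `B`. -/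
theorem IsUnionClosed.exists_sup {B : Set (Face Δ)} (hB : IsUnionClosed B) {A Z : Face Δ}
    (hA : A ∈ B) (hAZ : A ≤ Z) {T : Set (Face Δ)} (hT : T.Finite)
    (h : ∀ J ∈ T, J ∈ B ∧ J ≤ Z ∧ ∃ s, s ∈ A.1 ∧ s ∈ J.1) :
    ∃ K ∈ B, A ≤ K ∧ K ≤ Z ∧ ∀ J ∈ T, J ≤ K := by
  induction T, hT using Set.Finite.induction_on with
  | empty => exact ⟨A, hA, le_rfl, hAZ, by simp⟩
  | @insert J T _ _ ih =>
    obtain ⟨K, hK, hAK, hKZ, hTK⟩ := ih fun L hL => h L (Set.mem_insert_of_mem _ hL)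
    obtain ⟨hJ, hJZ, s, hsA, hsJ⟩ := h J (Set.mem_insert _ _)
    have hsub : K.1 ∪ J.1 ⊆ Z.1 := Finset.union_subset hKZ hJZ
    refine ⟨⟨K.1 ∪ J.1, Face.of_subset Z hsub⟩,
      hB.sup_mem K hK J hJ ⟨s, hAK hsA, hsJ⟩ _ fun t => Finset.mem_union,
      hAK.trans (Finset.subset_union_left), hsub, ?_⟩
    rintro L (rfl | hL)
    · exact Finset.subset_union_right
    · exact (hTK L hL).trans Finset.subset_union_left

/-- The maximal members form an antichain, whose join exists by nestedness; with fewer than two of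
them a bound is immediate. -/
theorem IsNested.exists_upper [Finite S] {B N : Set (Face Δ)} (hN : IsNested B N) :
    ∃ X : Face Δ, ∀ J ∈ N, J ≤ X := by
  let A : Set (Face Δ) := {J | Maximal (· ∈ N) J}
  have hA : ∀ J ∈ N, ∃ K ∈ A, J ≤ K := fun J hJ => by
    obtain ⟨K, hK, hm⟩ := (Set.toFinite N).exists_le_maximal hJ
    exact ⟨K, hm, hK⟩
  have hanti : IsAntichain (· ≤ ·) A := setOfPred_maximal_antichain _
  by_cases hnt : A.Nontrivial
  · obtain ⟨z, hz, -⟩ := hN.2 A (fun J hJ => hJ.1) hanti hnt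
    refine ⟨z, fun J hJ => ?_⟩
    obtain ⟨K, hK, hJK⟩ := hA J hJ
    exact hJK.trans (hz.1 hK)
  · rw [Set.not_nontrivial_iff] at hnt
    rcases hnt.eq_empty_or_singleton with h | ⟨X, h⟩
    · refine ⟨⊥, fun J hJ => ?_⟩
      obtain ⟨K, hK, -⟩ := hA J hJ
      exact absurd hK (h ▸ Set.notMem_empty K)
    · refine ⟨X, fun J hJ => ?_⟩
      obtain ⟨K, hK, hJK⟩ := hA J hJ
      rw [h, Set.mem_singleton_iff] at hK
      exact hK ▸ hJK

/-- Every `A ∈ B` has an element which lies only in those members of `N` that contain `A`. -/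
theorem IsUnionClosed.exists_argmin [Finite S] {B N : Set (Face Δ)} (hB : IsUnionClosed B)
    (hN : IsNested B N) {A : Face Δ} (hA : A ∈ B) :
    ∃ t ∈ A.1, ∀ J ∈ N, t ∈ J.1 → A ≤ J := by
  by_contra! hcon
  -- If the claim fails, these maximal members of `N` that meet `A` without containing it cover `A`.
  -- Two or more of them would have a join outside `B`, yet this join is a union of `A` with members
  -- of `B` meeting `A`. A single one would contain `A`.
  let T : Set (Face Δ) := {J | Maximal (fun J => J ∈ N ∧ (∃ s, s ∈ A.1 ∧ s ∈ J.1) ∧ ¬ A ≤ J) J}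
  have hT : ∀ t ∈ A.1, ∃ J ∈ T, t ∈ J.1 := fun t ht => by
    obtain ⟨J, hJ, htJ, hAJ⟩ := hcon t ht
    obtain ⟨K, hK, hm⟩ := (Set.toFinite
      {J | J ∈ N ∧ (∃ s, s ∈ A.1 ∧ s ∈ J.1) ∧ ¬ A ≤ J}).exists_le_maximal ⟨hJ, ⟨t, ht, htJ⟩, hAJ⟩
    exact ⟨K, hm, hK htJ⟩
  have hTN : T ⊆ N := fun J hJ => hJ.1.1
  by_cases hnt : T.Nontrivial
  · obtain ⟨z, hz, hzB⟩ := hN.2 T hTN (setOfPred_maximal_antichain _) hnt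
    have hz' := Face.isLUB_iff.1 hz
    obtain ⟨K, hK, -, hKz, hTK⟩ := hB.exists_sup hA
      (fun t ht => (hz' t).2 (hT t ht)) (Set.toFinite T)
      fun J hJ => ⟨hN.1 (hTN hJ), hz.1 hJ, hJ.1.2.1⟩
    exact hzB (le_antisymm hKz (hz.2 hTK) ▸ hK)
  · rw [Set.not_nontrivial_iff] at hnt
    obtain ⟨t, ht⟩ := hB.exists_mem hA
    obtain ⟨J, hJ, -⟩ := hT t ht
    refine hJ.1.2.2 fun u hu => ?_
    obtain ⟨K, hK, huK⟩ := hT u hu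
    exact hnt hK hJ ▸ huK

/-- Two members of a nested set that meet are comparable. -/
theorem IsUnionClosed.comparable {B N : Set (Face Δ)} (hB : IsUnionClosed B)
    (hN : IsNested B N) {J J' : Face Δ} (hJ : J ∈ N) (hJ' : J' ∈ N) {s : S} (hs : s ∈ J.1)
    (hs' : s ∈ J'.1) : J ≤ J' ∨ J' ≤ J := by
  by_contra! hcon
  have hne : J ≠ J' := fun h => hcon.1 h.le
  obtain ⟨z, hz, hzB⟩ := hN.2 {J, J'} (Set.insert_subset hJ (Set.singleton_subset_iff.2 hJ'))
    (by
      rintro a (rfl | rfl) b (rfl | rfl) hab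
      · exact absurd rfl hab
      · exact hcon.1
      · exact hcon.2
      · exact absurd rfl hab)
    ⟨J, by simp, J', by simp, hne⟩
  refine hzB (hB.sup_mem J (hN.1 hJ) J' (hN.1 hJ') ⟨s, hs, hs'⟩ z fun t => ?_)
  rw [Face.isLUB_iff.1 hz]
  simp

end Combinatorics

/-! ### Vertex coordinates and the nested support of a point -/

section Coordinates

variable {S : Type*} {Δ : AbstractSimplicialComplex S}

noncomputable instance [Finite S] : Fintype (Face Δ) := Fintype.ofFinite _

open scoped Classical in
/-- The coordinates of the conic combination of indicator vectors of faces with coefficients `a`. -/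
noncomputable def expand [Finite S] (a : Face Δ → ℝ) (s : S) : ℝ :=
  ∑ J : Face Δ, if s ∈ J.1 then a J else 0

/-- The coefficients `a` are nonnegative and supported on a `B`-nested set. -/
structure IsNestedCoeff (B : Set (Face Δ)) (a : Face Δ → ℝ) : Prop where
  nonneg : ∀ J, 0 ≤ a J
  nested : IsNested B {J | 0 < a J}

/-- The smallest nested set in whose cone the point with coordinates `c` lies. -/
def nestedSupport (B : Set (Face Δ)) (c : S → ℝ) : Set (Face Δ) :=
  {J | J ∈ B ∧ (∀ s ∈ J.1, 0 < c s) ∧ ∀ I ∈ B, J < I → ∃ t ∈ I.1, ∀ s ∈ J.1, c t < c s}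

/-- The coordinates of points in the support of the cone complex of `Δ`. -/
structure IsCoord (Δ : AbstractSimplicialComplex S) (c : S → ℝ) : Prop where
  nonneg : ∀ s, 0 ≤ c s
  supp : ∃ X : Face Δ, ∀ s, 0 < c s → s ∈ X.1

variable [Finite S] {B : Set (Face Δ)} {a : Face Δ → ℝ} {c : S → ℝ}

theorem expand_nonneg (ha : ∀ J, 0 ≤ a J) (s : S) : 0 ≤ expand a s :=
  Finset.sum_nonneg fun J _ => by split_ifs <;> simp [ha]

theorem expand_pos_iff (ha : ∀ J, 0 ≤ a J) (s : S) :
    0 < expand a s ↔ ∃ J, 0 < a J ∧ s ∈ J.1 := by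
  classical
  rw [expand, Finset.sum_pos_iff_of_nonneg fun J _ => by split_ifs <;> simp [ha]]
  refine exists_congr fun J => ?_
  split_ifs with h <;> simp [h]

theorem IsNestedCoeff.isCoord (ha : IsNestedCoeff B a) : IsCoord Δ (expand a) := by
  refine ⟨expand_nonneg ha.nonneg, ?_⟩
  obtain ⟨X, hX⟩ := ha.nested.exists_upper
  refine ⟨X, fun s hs => ?_⟩
  obtain ⟨J, hJ, hsJ⟩ := (expand_pos_iff ha.nonneg s).1 hs
  exact hX J hJ hsJ

open scoped Classical in
-- With `IsNestedCoeff.expand_argmin`, this computes the minimum of the coordinates over a member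
-- `A` of `B`.
theorem sum_above_le_expand (ha : ∀ J, 0 ≤ a J) {A : Face Δ} {s : S} (hs : s ∈ A.1) :
    (∑ J : Face Δ, if A ≤ J then a J else 0) ≤ expand a s := by
  refine Finset.sum_le_sum fun J _ => ?_
  by_cases h : A ≤ J
  · rw [if_pos h, if_pos (h hs)]
  · rw [if_neg h]
    split_ifs <;> simp [ha]

open scoped Classical in
theorem IsNestedCoeff.expand_argmin (ha : IsNestedCoeff B a) {A : Face Δ} {t : S}
    (htA : t ∈ A.1) (ht : ∀ J, 0 < a J → t ∈ J.1 → A ≤ J) :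
    expand a t = ∑ J : Face Δ, if A ≤ J then a J else 0 := by
  refine Finset.sum_congr rfl fun J _ => ?_
  rcases (ha.nonneg J).eq_or_lt with h | h
  · simp [← h]
  · exact if_congr ⟨fun hJ => ht J h hJ, fun hJ => hJ htA⟩ rfl rfl

/-- Compare minima over members of `B`. If `J` has positive coefficient, it counts towards the
minimum over `J` but not over any larger `I`, so the minimum drops strictly. If `J` has coefficient
zero, passing to the smallest supporting set above it does not change the minimum. -/
theorem IsNestedCoeff.pos_iff (hB : IsUnionClosed B) (ha : IsNestedCoeff B a) (J : Face Δ) :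
    0 < a J ↔ J ∈ nestedSupport B (expand a) := by
  classical
  constructor
  · intro hJ
    refine ⟨ha.nested.1 hJ, fun s hs => (expand_pos_iff ha.nonneg s).2 ⟨J, hJ, hs⟩,
      fun I hI hJI => ?_⟩
    obtain ⟨t, htI, ht⟩ := hB.exists_argmin ha.nested hI
    refine ⟨t, htI, fun s hs => ?_⟩
    rw [ha.expand_argmin htI fun K hK => ht K hK]
    refine lt_of_lt_of_le ?_ (sum_above_le_expand ha.nonneg hs)
    refine Finset.sum_lt_sum (fun K _ => ?_) ⟨J, Finset.mem_univ _, ?_⟩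
    · by_cases h : I ≤ K
      · rw [if_pos h, if_pos (hJI.le.trans h)]
      · rw [if_neg h]
        split_ifs <;> simp [ha.nonneg]
    · rw [if_neg hJI.not_ge, if_pos le_rfl]
      exact hJ
  · rintro ⟨hJB, hpos, hJ⟩
    obtain ⟨t, htJ, ht⟩ := hB.exists_argmin ha.nested hJB
    obtain ⟨L, hL, htL⟩ := (expand_pos_iff ha.nonneg t).1 (hpos t htJ)
    -- Supporting sets containing `J` are pairwise comparable, so a minimal one `Z` lies in all of
    -- them. If `Z ≠ J`, the minima over `J` and `Z` agree, contrary to the strict drop required by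
    -- `nestedSupport`.
    obtain ⟨Z, -, hZ⟩ := (Set.toFinite {L | 0 < a L ∧ J ≤ L}).exists_le_minimal
      (a := L) ⟨hL, ht L hL htL⟩
    rcases eq_or_ne J Z with rfl | hne
    · exact hZ.1.1
    exfalso
    obtain ⟨u, huZ, hu⟩ := hJ Z (ha.nested.1 hZ.1.1) (lt_of_le_of_ne hZ.1.2 hne)
    refine (hu t htJ).not_ge ?_
    rw [ha.expand_argmin htJ fun K hK => ht K hK]
    refine le_trans (Finset.sum_le_sum fun K _ => ?_) (sum_above_le_expand ha.nonneg huZ)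
    by_cases hK : J ≤ K
    · rw [if_pos hK]
      rcases (ha.nonneg K).eq_or_lt with h | h
      · simp [← h]
      · have hZK : Z ≤ K := by
          rcases hB.comparable ha.nested hZ.1.1 h (hZ.1.2 htJ) (hK htJ) with h1 | h1
          · exact h1
          · exact hZ.2 ⟨h, hK⟩ h1
        rw [if_pos hZK]
    · rw [if_neg hK]
      split_ifs <;> simp [ha.nonneg]

theorem expand_add (a b : Face Δ → ℝ) (s : S) :
    expand (fun J => a J + b J) s = expand a s + expand b s := by
  classical
  rw [expand, expand, expand, ← Finset.sum_add_distrib]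
  exact Finset.sum_congr rfl fun J _ => by split_ifs <;> simp

open scoped Classical in
theorem expand_single (K : Face Δ) (r : ℝ) (s : S) :
    expand (Pi.single K r) s = if s ∈ K.1 then r else 0 := by
  rw [expand, Finset.sum_eq_single K]
  · simp
  · intro J _ hJ
    simp [hJ]
  · simp

/-- Every point with coordinates supported on a face is a positive combination of the indicator
vectors of a nested set. -/
theorem IsUnionClosed.exists_expand (hB : IsUnionClosed B) (hc : IsCoord Δ c) :
    ∃ a : Face Δ → ℝ, IsNestedCoeff B a ∧ expand a = c := by
  classical
  cases nonempty_fintype S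
  obtain ⟨X, hX⟩ := hc.supp
  have hc0 := hc.nonneg
  clear hc
  induction hn : (Finset.univ.filter fun s => 0 < c s).card using Nat.strong_induction_on
    generalizing c X with
  | _ n ih =>
  by_cases hz : ∃ s, 0 < c s
  swap
  · push Not at hz
    refine ⟨0, ⟨fun _ => le_rfl, ?_, ?_⟩, ?_⟩
    · intro J hJ
      exact absurd (show (0 : ℝ) < 0 from hJ) (lt_irrefl _)
    · intro A hA _ hnt
      obtain ⟨x, hx⟩ := hnt.nonempty
      exact absurd (show (0 : ℝ) < 0 from hA hx) (lt_irrefl _)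
    · ext s
      simp [expand, le_antisymm (hz s) (hc0 s)]
  obtain ⟨s₀, hs₀⟩ := hz
  let Y : Face Δ := ⟨X.1.filter fun s => 0 < c s, X.of_subset (Finset.filter_subset _ _)⟩
  have hY : ∀ s, s ∈ Y.1 ↔ 0 < c s := fun s =>
    ⟨fun h => (Finset.mem_filter.1 h).2, fun h => Finset.mem_filter.2 ⟨hX s h, h⟩⟩
  -- Greedy step: take a maximal member `K` of `B` inside the support `Y` and subtract the minimum
  -- `c t` of `c` on `K`. The vertex `t` leaves the support, so the induction applies.
  obtain ⟨K, hK, hs₀K⟩ := exists_maxBelow_le (hB.single_mem s₀) (Face.single_le.2 ((hY s₀).2 hs₀))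
  obtain ⟨t, htK, ht⟩ := K.1.exists_min_image c ⟨s₀, Face.single_le.1 hs₀K⟩
  have htpos : 0 < c t := (hY t).1 (hK.1.2 htK)
  let c' : S → ℝ := fun s => if s ∈ K.1 then c s - c t else c s
  have hc'le : ∀ s, c' s ≤ c s := fun s => by
    simp only [c']; split_ifs <;> linarith
  have hc'0 : ∀ s, 0 ≤ c' s := fun s => by
    simp only [c']
    split_ifs with h
    · exact sub_nonneg.2 (ht s h)
    · exact hc0 s
  have hsub : (Finset.univ.filter fun s => 0 < c' s) ⊂ Finset.univ.filter fun s => 0 < c s := by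
    refine (Finset.ssubset_iff_of_subset fun s hs => ?_).2 ⟨t, ?_, ?_⟩
    · simp only [Finset.mem_filter, Finset.mem_univ, true_and] at hs ⊢
      exact hs.trans_le (hc'le s)
    · simpa using htpos
    · simp [c', htK]
  obtain ⟨a, ha, hac⟩ := ih _ (hn ▸ Finset.card_lt_card hsub) X
    (fun s hs => hX s (hs.trans_le (hc'le s))) hc'0 rfl
  have hsupp : ∀ J, 0 < a J → J ≤ Y := fun J hJ s hs => by
    rw [hY]
    refine lt_of_lt_of_le ?_ (hc'le s)
    rw [← hac]
    exact (expand_pos_iff ha.nonneg s).2 ⟨J, hJ, hs⟩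
  refine ⟨fun J => a J + Pi.single (M := fun _ => ℝ) K (c t) J, ⟨fun J => ?_, ?_, ?_⟩, ?_⟩
  · refine add_nonneg (ha.nonneg J) ?_
    rw [Pi.single_apply]
    split_ifs
    · exact htpos.le
    · exact le_rfl
  · intro J hJ
    by_cases h : J = K
    · exact h ▸ hK.1.1
    · exact ha.nested.1 (by simpa [h] using hJ)
  · intro A hA hanti hnt
    have hAY : ∀ J ∈ A, J ≤ Y := fun J hJ => by
      by_cases h : J = K
      · exact h ▸ hK.1.2
      · exact hsupp J (by simpa [h] using hA hJ)
    by_cases hKA : K ∈ A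
    · obtain ⟨z, hz, hzY⟩ := Face.exists_isLUB hAY
      refine ⟨z, hz, fun hzB => ?_⟩
      -- The join stays inside the old support `Y`, so maximality of `K` there rules out a larger
      -- join in `B`.
      have hzK : z = K := le_antisymm (hK.2 ⟨hzB, hzY⟩ (hz.1 hKA)) (hz.1 hKA)
      obtain ⟨L, hL, hLK⟩ := hnt.exists_ne K
      exact hanti hL hKA hLK (hzK ▸ hz.1 hL)
    · exact ha.nested.2 A (fun J hJ => by
        have h : J ≠ K := fun h => hKA (h ▸ hJ)
        simpa [h] using hA hJ) hanti hnt
  · ext s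
    rw [expand_add, expand_single, hac]
    simp only [c']
    split_ifs <;> ring

theorem IsUnionClosed.nestedSupport_isNested (hB : IsUnionClosed B) (hc : IsCoord Δ c) :
    IsNested B (nestedSupport B c) := by
  obtain ⟨a, ha, rfl⟩ := hB.exists_expand hc
  convert ha.nested using 1
  ext J
  exact (ha.pos_iff hB J).symm

/-- `y` lies in the smallest cone containing `y₀`, in terms of coordinates. -/
def Dominated (B : Set (Face Δ)) (y y₀ : S → ℝ) : Prop :=
  (∀ s, 0 < y s → 0 < y₀ s) ∧
    ∀ I ∈ B, ∀ i ∈ I.1, (∀ j ∈ I.1, y₀ i ≤ y₀ j) → ∀ j ∈ I.1, y i ≤ y j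

/-- The minimizers over `I ∈ B` are the vertices lying only in those supporting sets that contain
`I`; shrinking the support can only add such vertices. Domination, unlike nestedness, can be tested
on one member of `B` at a time. -/
theorem IsUnionClosed.nestedSupport_subset_iff (hB : IsUnionClosed B) {y y₀ : S → ℝ}
    (hy : IsCoord Δ y) (hy₀ : IsCoord Δ y₀) :
    nestedSupport B y ⊆ nestedSupport B y₀ ↔ Dominated B y y₀ := by
  classical
  constructor
  · intro h
    obtain ⟨a, ha, rfl⟩ := hB.exists_expand hy
    obtain ⟨b, hb, rfl⟩ := hB.exists_expand hy₀
    have hab : ∀ J, 0 < a J → 0 < b J := fun J hJ =>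
      (hb.pos_iff hB J).2 (h ((ha.pos_iff hB J).1 hJ))
    refine ⟨fun s hs => ?_, fun I hI i hi hmin j hj => ?_⟩
    · obtain ⟨J, hJ, hsJ⟩ := (expand_pos_iff ha.nonneg s).1 hs
      exact (expand_pos_iff hb.nonneg s).2 ⟨J, hab J hJ, hsJ⟩
    · have hiI : ∀ J, 0 < b J → i ∈ J.1 → I ≤ J := by
        by_contra! hcon
        obtain ⟨J, hJ, hiJ, hIJ⟩ := hcon
        obtain ⟨t, htI, ht⟩ := hB.exists_argmin hb.nested hI
        refine (hmin t htI).not_gt ?_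
        rw [hb.expand_argmin htI fun K hK => ht K hK]
        refine Finset.sum_lt_sum (fun K _ => ?_) ⟨J, Finset.mem_univ _, ?_⟩
        · by_cases h : I ≤ K
          · rw [if_pos h, if_pos (h hi)]
          · rw [if_neg h]
            split_ifs <;> simp [hb.nonneg]
        · rw [if_neg hIJ, if_pos hiJ]
          exact hJ
      rw [ha.expand_argmin hi fun J hJ => hiI J (hab J hJ)]
      exact sum_above_le_expand ha.nonneg hj
  · rintro ⟨hs, hmin⟩ J ⟨hJB, hpos, hJ⟩
    refine ⟨hJB, fun s hsJ => hs s (hpos s hsJ), fun I hI hJI => ?_⟩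
    obtain ⟨t, htI, ht⟩ := hJ I hI hJI
    obtain ⟨t', ht'I, ht'⟩ := I.1.exists_min_image y₀ ⟨t, htI⟩
    -- In case of equality `s` would minimize `y₀` over `I`, hence also `y`, against `y t < y s`.
    refine ⟨t', ht'I, fun s hsJ => lt_of_le_of_ne (ht' s (hJI.le hsJ)) fun heq => ?_⟩
    exact (ht s hsJ).not_ge (hmin I hI s (hJI.le hsJ) (fun j hj => heq ▸ ht' j hj) t htI)

end Coordinates

section Dominated

variable {S : Type*} {Δ : AbstractSimplicialComplex S} {B : Set (Face Δ)}

/-- Minimizing over a singleton is no condition, so only `I` contributes. `Nonempty S` provides a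
member of `B`, from which the positivity clause is recovered. -/
theorem dominated_iff_forall_singleFaceSet (hB : IsUnionClosed B) [Nonempty S] {y y₀ : S → ℝ} :
    Dominated B y y₀ ↔ ∀ I ∈ B, Dominated (singleFaceSet I) y y₀ := by
  constructor
  · rintro ⟨h1, h2⟩ I hI
    refine ⟨h1, ?_⟩
    rintro J (rfl | ⟨s, hs⟩) i hi hmin j hj
    · exact h2 J hI i hi hmin j hj
    · rw [hs, Finset.mem_singleton] at hi hj
      rw [hi, hj]
  · intro h
    obtain ⟨s⟩ := ‹Nonempty S›
    exact ⟨(h _ (hB.single_mem s)).1, fun I hI => (h I hI).2 I (Or.inl rfl)⟩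

theorem Dominated.mono {B' : Set (Face Δ)} {y y₀ : S → ℝ} (h : Dominated B' y y₀) (hB : B ⊆ B') :
    Dominated B y y₀ :=
  ⟨h.1, fun I hI => h.2 I (hB hI)⟩

end Dominated

/-! ### Ray contractions of the facial preposet and members of the nested set -/

section NestedCones

variable {S : Type*} {Δ : AbstractSimplicialComplex S} {E : Type*} [AddCommGroup E] [Module ℝ E]

theorem mem_hull_image_iff {ι : Type*} [Fintype ι] {f : ι → E} {N : Set ι} {x : E} :
    x ∈ PointedCone.hull ℝ (f '' N) ↔
      ∃ a : ι → ℝ, (∀ i, 0 ≤ a i) ∧ (∀ i, 0 < a i → i ∈ N) ∧ x = ∑ i, a i • f i := by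
  classical
  constructor
  · intro hx
    induction hx using Submodule.span_induction with
    | mem x hx =>
      obtain ⟨i, hi, rfl⟩ := hx
      refine ⟨Pi.single i 1, fun j => ?_, fun j hj => ?_, ?_⟩
      · rw [Pi.single_apply]
        split_ifs <;> simp
      · by_contra h
        have : j ≠ i := fun h' => h (h' ▸ hi)
        simp [this] at hj
      · rw [Finset.sum_eq_single i] <;> simp +contextual
    | zero => exact ⟨0, fun _ => le_rfl, fun i hi => absurd hi (lt_irrefl _), by simp⟩
    | add x y _ _ hx hy =>
      obtain ⟨a, ha, haN, rfl⟩ := hx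
      obtain ⟨b, hb, hbN, rfl⟩ := hy
      refine ⟨fun i => a i + b i, fun i => add_nonneg (ha i) (hb i), fun i hi => ?_, ?_⟩
      · rcases (ha i).eq_or_lt with h | h
        · exact hbN i (by simpa [← h] using hi)
        · exact haN i h
      · simp only [add_smul, Finset.sum_add_distrib]
    | smul r x _ hx =>
      obtain ⟨a, ha, haN, rfl⟩ := hx
      refine ⟨fun i => r * a i, fun i => mul_nonneg r.2 (ha i), fun i hi => haN i ?_, ?_⟩
      · exact (pos_iff_pos_of_mul_pos hi).1 (lt_of_le_of_ne r.2 fun h => by simp [← h] at hi)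
      · rw [Finset.smul_sum]
        exact Finset.sum_congr rfl fun i _ => by rw [mul_smul]; rfl
  · rintro ⟨a, ha, haN, rfl⟩
    refine Submodule.sum_mem _ fun i _ => ?_
    rcases (ha i).eq_or_lt with h | h
    · rw [← h, zero_smul]
      exact Submodule.zero_mem _
    · exact PointedCone.smul_mem _ h.le (Submodule.subset_span ⟨i, haN i h, rfl⟩)

/-- The sum of the vectors indexed by the vertices of a face. -/
def faceVec (v : S → E) (J : Face Δ) : E := ∑ s ∈ J.1, v s

/-- The cone spanned by the vectors of the members of `N`. -/
def nestedCone (v : S → E) (N : Set (Face Δ)) : PointedCone ℝ E :=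
  PointedCone.hull ℝ (faceVec v '' N)

theorem facialPreposet_none (N : Set (Face Δ)) (i : Option S) : facialPreposet N i none := by
  intro I _ h
  obtain ⟨s, _, hs⟩ := h
  exact absurd hs (by simp)

theorem facialPreposet_some {N : Set (Face Δ)} {i j : S} :
    facialPreposet N (some i) (some j) ↔ ∀ I ∈ N, j ∈ I.1 → i ∈ I.1 := by
  simp [facialPreposet]

theorem exists_isContraction_ray [Finite S] {B N : Set (Face Δ)} (hB : IsUnionClosed B)
    (hN : IsNested B N) {J : Face Δ} (hJ : J ∈ N) :
    ∃ R : Option S → Option S → Prop, IsRayPreposet R ∧ IsContraction R (facialPreposet N) ∧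
      finiteElements R = (J.1 : Set S) := by
  obtain ⟨t, htJ, ht⟩ := hB.exists_argmin hN (hN.1 hJ)
  let A : Set (Option S) := some '' (J.1 : Set S)
  have hnone : (none : Option S) ∉ A := by simp [A]
  let R : Option S → Option S → Prop := fun x y => x ∈ A ∨ y ∉ A
  have htA : some t ∈ A := ⟨t, htJ, rfl⟩
  have hQt : ∀ x ∈ A, facialPreposet N x (some t) := by
    rintro _ ⟨i, hi, rfl⟩
    exact facialPreposet_some.2 fun I hI htI => ht I hI htI hi
  have hQR : ∀ x y, facialPreposet N x y → R x y := fun x y h => by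
    by_cases hy : y ∈ A
    · exact Or.inl (h J hJ hy)
    · exact Or.inr hy
  -- Reverse every relation that stays within `A` or within its complement. Since `t` is above all
  -- of `A` and `∞` is above everything, each of the two sets becomes one class.
  refine ⟨R, ⟨A, ⟨_, htA⟩, ⟨none, hnone⟩, fun _ _ => Iff.rfl⟩,
    ⟨fun x y => facialPreposet N x y ∧ R y x, fun _ _ h => h.1, fun x y => ⟨fun h => ?_,
      fun h => ?_⟩⟩, ?_⟩
  · have up : ∀ z, Relation.ReflTransGen
        (fun a b => facialPreposet N a b ∨ facialPreposet N b a ∧ R a b) z none := fun z =>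
      .single (Or.inl (facialPreposet_none N z))
    by_cases hy : y ∈ A
    · have hx : x ∈ A := h.resolve_right (not_not_intro hy)
      exact .tail (b := some t) (.single (Or.inl (hQt x hx))) (Or.inr ⟨hQt y hy, Or.inl htA⟩)
    · exact (up x).tail (Or.inr ⟨facialPreposet_none N y, Or.inr hy⟩)
  · induction h with
    | refl => exact em _
    | @tail y z _ hyz ih =>
      have hyz' : R y z := hyz.elim (hQR y z) fun h => h.2
      rcases ih with h | h
      · exact Or.inl h
      · exact Or.inr fun hz => h (hyz'.resolve_right (not_not_intro hz))
  · ext i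
    simp [finiteElements, R, A]

theorem exists_of_isContraction_ray [Finite S] {B N : Set (Face Δ)} (hB : IsUnionClosed B)
    (hN : IsNested B N) {R : Option S → Option S → Prop} (hR : IsRayPreposet R)
    (hRQ : IsContraction R (facialPreposet N)) :
    ∃ J ∈ N, finiteElements R = (J.1 : Set S) := by
  obtain ⟨A, ⟨x₀, hx₀⟩, ⟨y₀, hy₀⟩, hRA⟩ := hR
  obtain ⟨R₀, hR₀, hRT⟩ := hRQ
  have hQR : ∀ x y, facialPreposet N x y → R x y := fun x y h => (hRT x y).2 (.single (Or.inl h))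
  have hnone : none ∉ A := fun h =>
    hy₀ (((hRA _ _).1 (hQR y₀ none (facialPreposet_none N y₀))).resolve_right (not_not_intro h))
  -- Some member of `N` contains `j`, since otherwise `∞ ≼ j` would put `∞` in the lower class. The
  -- smallest such member consists of elements `≼ j`, so it lies in `A`.
  have hM : ∀ j, some j ∈ A → ∃ M ∈ N, j ∈ M.1 ∧ some '' (M.1 : Set S) ⊆ A := by
    intro j hj
    have h1 : ∃ I ∈ N, j ∈ I.1 := by
      by_contra! hcon
      have : facialPreposet N none (some j) := by
        rintro I hI ⟨s, hs, hsj⟩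
        rw [Option.some.injEq] at hsj
        exact absurd (hsj ▸ hs) (hcon I hI)
      rcases (hRA _ _).1 (hQR _ _ this) with h | h
      · exact hnone h
      · exact h hj
    obtain ⟨I, hI, hjI⟩ := h1
    obtain ⟨M, -, hMm⟩ := (Set.toFinite {I | I ∈ N ∧ j ∈ I.1}).exists_le_minimal (a := I) ⟨hI, hjI⟩
    refine ⟨M, hMm.1.1, hMm.1.2, ?_⟩
    rintro _ ⟨i, hi, rfl⟩
    refine ((hRA _ _).1 (hQR (some i) (some j) (facialPreposet_some.2 fun L hL hjL => ?_))).resolve_right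
      (not_not_intro hj)
    rcases hB.comparable hN hMm.1.1 hL hMm.1.2 hjL with h | h
    · exact h hi
    · exact hMm.2 ⟨hL, hjL⟩ h hi
  obtain _ | i₀ := x₀
  · exact absurd hx₀ hnone
  obtain ⟨M₀, hM₀, hi₀, hM₀A⟩ := hM i₀ hx₀
  obtain ⟨J, hM₀J, hJ⟩ := (Set.toFinite {I | I ∈ N ∧ some '' (I.1 : Set S) ⊆ A}).exists_le_maximal
    (a := M₀) ⟨hM₀, hM₀A⟩
  -- A chain ending at `i₀` cannot leave `J`: original relations respect `J`, and a reversed one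
  -- leads to a `y` whose member `M ⊆ A` meets `J`, so `M ⊆ J` by maximality. As all of `A` is below
  -- `i₀`, this gives `A = J`.
  have hback : ∀ y, Relation.ReflTransGen (fun a b => facialPreposet N a b ∨ R₀ b a) y (some i₀) →
      y ∈ some '' (J.1 : Set S) := by
    intro y hy
    induction hy using Relation.ReflTransGen.head_induction_on with
    | refl => exact ⟨i₀, hM₀J hi₀, rfl⟩
    | @head y z hyz hz ih =>
      rcases hyz with h | h
      · exact h J hJ.1.1 ih
      · have hyA : y ∈ A := ((hRA y _).1 ((hRT y _).2 (.head (Or.inr h) hz))).resolve_right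
          (not_not_intro hx₀)
        obtain _ | y := y
        · exact absurd hyA hnone
        obtain ⟨M, hMN, hyM, hMA⟩ := hM y hyA
        obtain ⟨z', hz'M, hz'⟩ := hR₀ _ _ h M hMN ⟨y, hyM, rfl⟩
        obtain ⟨z'', hz''J, hz''⟩ := ih
        have hzz : z' = z'' := Option.some_injective _ (hz'.trans hz''.symm)
        refine ⟨y, ?_, rfl⟩
        rcases hB.comparable hN hMN hJ.1.1 hz'M (hzz ▸ hz''J) with h' | h'
        · exact h' hyM
        · exact hJ.2 ⟨hMN, hMA⟩ h' hyM
  have hA : A = some '' (J.1 : Set S) := by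
    refine Set.Subset.antisymm (fun y hy => hback y ?_) hJ.1.2
    exact (hRT _ _).1 ((hRA _ _).2 (Or.inl hy))
  refine ⟨J, hJ.1.1, ?_⟩
  ext i
  simp [finiteElements, hRA, hA]

theorem braidCone_facialPreposet [Finite S] {B N : Set (Face Δ)} (hB : IsUnionClosed B)
    (hN : IsNested B N) (v : S → E) :
    braidCone v (facialPreposet N) = nestedCone v N := by
  unfold braidCone nestedCone
  congr 1
  ext w
  constructor
  · rintro ⟨R, hR, hRQ, rfl⟩
    obtain ⟨J, hJ, hRJ⟩ := exists_of_isContraction_ray hB hN hR hRQ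
    exact ⟨J, hJ, by rw [hRJ, finsum_mem_coe_finset]; rfl⟩
  · rintro ⟨J, hJ, rfl⟩
    obtain ⟨R, hR, hRQ, hRJ⟩ := exists_isContraction_ray hB hN hJ
    exact ⟨R, hR, hRQ, by rw [hRJ, finsum_mem_coe_finset]; rfl⟩

theorem nestedFan_eq [Finite S] {B : Set (Face Δ)} (hB : IsUnionClosed B) (v : S → E) :
    nestedFan v B = {C | ∃ N, IsNested B N ∧ C = nestedCone v N} := by
  ext C
  exact exists_congr fun N => and_congr_right fun hN => by rw [braidCone_facialPreposet hB hN]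

end NestedCones

/-! ### The nested fan over a non-degenerate cone complex -/

section NonDegenerate

theorem IsNested.isNestedCoeff {S : Type*} {Δ : AbstractSimplicialComplex S} {B N : Set (Face Δ)}
    (hN : IsNested B N) {a : Face Δ → ℝ} (ha : ∀ J, 0 ≤ a J)
    (haN : ∀ J, 0 < a J → J ∈ N) : IsNestedCoeff B a :=
  ⟨ha, hN.mono haN⟩

theorem isUnionClosed_singleFaceSet_of_mem {S : Type*} {Δ : AbstractSimplicialComplex S} {B : Set (Face Δ)}
    (hB : IsUnionClosed B) (I : B) :
    IsUnionClosed (singleFaceSet (I : Face Δ)) :=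
  isUnionClosed_singleFaceSet fun h => hB.bot_notMem (h ▸ I.2)

attribute [local instance] Fintype.ofFinite

variable {S : Type*} [Finite S] {Δ : AbstractSimplicialComplex S} {E : Type*} [AddCommGroup E]
  [Module ℝ E] {v : S → E} {B N N' : Set (Face Δ)}

/-- The point with given coordinates. -/
noncomputable def point (v : S → E) (c : S → ℝ) : E := ∑ s, c s • v s

theorem point_expand (v : S → E) (a : Face Δ → ℝ) :
    point v (expand a) = ∑ J, a J • faceVec v J := by
  classical
  simp only [point, expand, faceVec, Finset.sum_smul, Finset.smul_sum]
  rw [Finset.sum_comm]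
  refine Finset.sum_congr rfl fun J _ => ?_
  simp only [ite_smul, zero_smul]
  rw [← Finset.sum_filter]
  exact Finset.sum_congr (by ext; simp) fun _ _ => rfl

theorem point_add (v : S → E) (c d : S → ℝ) : point v (c + d) = point v c + point v d := by
  simp [point, add_smul, Finset.sum_add_distrib]

theorem linearIndepOn_of_finrank {I : Finset S}
    (h : Module.finrank ℝ (Submodule.span ℝ (faceCone v (I : Set S) : Set E)) = I.card)
    {c : S → ℝ} (hc : ∀ s, s ∉ I → c s = 0) (h0 : point v c = 0) : c = 0 := by
  have hspan : Submodule.span ℝ (faceCone v (I : Set S) : Set E) =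
      Submodule.span ℝ (Set.range fun s : I => v s) := by
    have hr : Set.range (fun s : I => v s) = v '' (I : Set S) := by
      ext x; simp
    rw [hr]
    refine le_antisymm (Submodule.span_le.2 fun x hx => PointedCone.hull_le_span ℝ _ hx) ?_
    exact Submodule.span_mono Submodule.subset_span
  rw [hspan] at h
  have hli : LinearIndependent ℝ fun s : I => v s := by
    rw [linearIndependent_iff_card_eq_finrank_span, Set.finrank, h]
    simp
  rw [Fintype.linearIndependent_iff] at hli
  have hsum : ∑ s : I, c s • v s = 0 := by
    rw [Finset.sum_coe_sort I fun s => c s • v s, ← h0, point]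
    exact Finset.sum_subset (Finset.subset_univ _) fun s _ hs => by rw [hc s hs, zero_smul]
  ext s
  by_cases hs : s ∈ I
  · exact hli (fun s => c s) hsum ⟨s, hs⟩
  · exact hc s hs

/-- Over a non-degenerate cone complex, points have unique coordinates. -/
theorem NonDegenerate.point_injOn (hv : NonDegenerate Δ v) {c d : S → ℝ} (hc : IsCoord Δ c)
    (hd : IsCoord Δ d) (h : point v c = point v d) : c = d := by
  obtain ⟨X, hX⟩ := hc.supp
  obtain ⟨Y, hY⟩ := hd.supp
  have h1 : point v c ∈ faceCone v (X.1 : Set S) := mem_hull_image_iff.2 ⟨c, hc.nonneg, hX, rfl⟩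
  have h2 : point v c ∈ faceCone v (Y.1 : Set S) :=
    mem_hull_image_iff.2 ⟨d, hd.nonneg, hY, h⟩
  -- The point has coordinates `e` supported on `X ∩ Y`; independence on `X` gives `c = e`, and
  -- independence on `Y` gives `d = e`.
  have h3 : point v c ∈ faceCone v ((X.1 : Set S) ∩ (Y.1 : Set S)) := hv.1 X Y ▸ ⟨h1, h2⟩
  obtain ⟨e, he, heXY, hce⟩ := mem_hull_image_iff.1 h3
  have zero_of : ∀ {f : S → ℝ} {T : Set S}, (∀ s, 0 ≤ f s) → (∀ s, 0 < f s → s ∈ T) →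
      ∀ s, s ∉ T → f s = 0 := fun hf hT s hs => le_antisymm (not_lt.1 fun h => hs (hT s h)) (hf s)
  have key : ∀ {f : S → ℝ} (Z : Face Δ), (∀ s, s ∉ Z.1 → f s = 0) → (∀ s, s ∉ Z.1 → e s = 0) →
      point v f = point v e → f = e := by
    intro f Z hf he' hfe
    refine sub_eq_zero.1 (linearIndepOn_of_finrank (v := v) (hv.2 Z) (c := f - e) (fun s hs => ?_)
      ?_)
    · simp [hf s hs, he' s hs]
    · have := point_add v (f - e) e
      rw [sub_add_cancel, hfe] at this
      simpa using this
  have hce' : point v c = point v e := hce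
  rw [key X (zero_of hc.nonneg hX) (zero_of he fun s hs => (heXY s hs).1) hce',
    key Y (zero_of hd.nonneg hY) (zero_of he fun s hs => (heXY s hs).2) (h ▸ hce')]

theorem IsNested.exists_coeff_of_mem (hN : IsNested B N) {x : E} (hx : x ∈ nestedCone v N) :
    ∃ a : Face Δ → ℝ, IsNestedCoeff B a ∧ (∀ J, 0 < a J → J ∈ N) ∧ x = point v (expand a) := by
  obtain ⟨a, ha, haN, rfl⟩ := mem_hull_image_iff.1 hx
  exact ⟨a, hN.isNestedCoeff ha haN, haN, (point_expand v a).symm⟩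

/-- A point lies in the cone of a nested set iff its supporting nested set is contained in it. -/
theorem NonDegenerate.point_mem_nestedCone_iff (hv : NonDegenerate Δ v) (hB : IsUnionClosed B)
    (hN : IsNested B N) {c : S → ℝ} (hc : IsCoord Δ c) :
    point v c ∈ nestedCone v N ↔ nestedSupport B c ⊆ N := by
  constructor
  · intro h
    obtain ⟨a, ha, haN, hca⟩ := hN.exists_coeff_of_mem h
    rw [hv.point_injOn hc ha.isCoord hca]
    exact fun J hJ => haN J ((ha.pos_iff hB J).2 hJ)
  · intro h
    obtain ⟨a, ha, rfl⟩ := hB.exists_expand hc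
    rw [point_expand]
    exact mem_hull_image_iff.2 ⟨a, ha.nonneg, fun J hJ => h ((ha.pos_iff hB J).1 hJ), rfl⟩

theorem IsNested.exists_coord_of_mem (hN : IsNested B N) {x : E} (hx : x ∈ nestedCone v N) :
    ∃ c : S → ℝ, IsCoord Δ c ∧ x = point v c := by
  obtain ⟨a, ha, -, rfl⟩ := hN.exists_coeff_of_mem hx
  exact ⟨_, ha.isCoord, rfl⟩

/-- The sum of the indicator vectors of the members of `N` has all its coefficients on `N` positive.
-/
theorem IsNested.exists_nestedSupport_eq (hB : IsUnionClosed B) (hN : IsNested B N) :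
    ∃ c : S → ℝ, IsCoord Δ c ∧ nestedSupport B c = N := by
  classical
  have hiff : ∀ J, (0 : ℝ) < (if J ∈ N then 1 else 0) ↔ J ∈ N := fun J => by
    split_ifs with h <;> simp [h]
  have ha : IsNestedCoeff B fun J => if J ∈ N then (1 : ℝ) else 0 :=
    hN.isNestedCoeff (fun J => by split_ifs <;> simp) fun J => (hiff J).1
  exact ⟨_, ha.isCoord, Set.ext fun J => (ha.pos_iff hB J).symm.trans (hiff J)⟩

theorem nestedCone_le_iff (hv : NonDegenerate Δ v) (hB : IsUnionClosed B) (hN : IsNested B N)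
    {C : PointedCone ℝ E} :
    nestedCone v N ≤ C ↔ ∀ c, IsCoord Δ c → nestedSupport B c ⊆ N → point v c ∈ C := by
  constructor
  · exact fun h c hc hcN => h ((hv.point_mem_nestedCone_iff hB hN hc).2 hcN)
  · intro h x hx
    obtain ⟨c, hc, rfl⟩ := hN.exists_coord_of_mem hx
    exact h c hc ((hv.point_mem_nestedCone_iff hB hN hc).1 hx)

open scoped Classical in
theorem nestedFan_isFan (hv : NonDegenerate Δ v) (hB : IsUnionClosed B) :
    IsFan (nestedFan v B) := by
  rw [nestedFan_eq hB]
  refine ⟨?_, ?_, ?_, ?_⟩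
  · refine (Set.finite_range (nestedCone v : Set (Face Δ) → PointedCone ℝ E)).subset ?_
    rintro _ ⟨N, -, rfl⟩
    exact ⟨N, rfl⟩
  · rintro _ ⟨N, -, rfl⟩
    exact Submodule.fg_span (Set.toFinite _)
  · rintro _ ⟨N, hN, rfl⟩ D hD
    refine ⟨{J | J ∈ N ∧ faceVec v J ∈ D}, hN.mono fun J hJ => hJ.1, le_antisymm ?_ ?_⟩
    · intro x hx
      obtain ⟨a, ha, haN, rfl⟩ := mem_hull_image_iff.1 (hD.le hx)
      refine mem_hull_image_iff.2 ⟨a, ha, fun J hJ => ⟨haN J hJ, ?_⟩, rfl⟩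
      rw [← Finset.add_sum_erase _ _ (Finset.mem_univ J)] at hx
      refine hD.mem_of_smul_add_mem (Submodule.subset_span ⟨J, haN J hJ, rfl⟩)
        (Submodule.sum_mem _ fun K _ => ?_) hJ hx
      rcases (ha K).eq_or_lt with h | h
      · rw [← h, zero_smul]
        exact Submodule.zero_mem _
      · exact PointedCone.smul_mem _ h.le (Submodule.subset_span ⟨K, haN K h, rfl⟩)
    · refine Submodule.span_le.2 ?_
      rintro _ ⟨J, hJ, rfl⟩
      exact hJ.2
  · rintro _ ⟨N, hN, rfl⟩ _ ⟨N', hN', rfl⟩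
    refine ⟨inf_le_left, fun {x y r} hx hy hr hxy => ⟨hx, ?_⟩⟩
    obtain ⟨a, ha, haN, rfl⟩ := mem_hull_image_iff.1 hx
    obtain ⟨b, hb, hbN, rfl⟩ := mem_hull_image_iff.1 hy
    -- The support of `r * a + b` contains that of `a`; once it lies in `N'`, the first summand lies
    -- in the cone of `N'`.
    have he : IsNestedCoeff B fun J => r * a J + b J :=
      hN.isNestedCoeff (fun J => add_nonneg (mul_nonneg hr.le (ha J)) (hb J)) fun J hJ => by
        rcases (ha J).eq_or_lt with h | h
        · exact hbN J (by simpa [← h] using hJ)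
        · exact haN J h
    have hmem := hxy.2
    rw [Finset.smul_sum, ← Finset.sum_add_distrib] at hmem
    simp only [smul_smul, ← add_smul] at hmem
    rw [← point_expand] at hmem
    replace hmem := (hv.point_mem_nestedCone_iff hB hN' he.isCoord).1 hmem
    refine mem_hull_image_iff.2 ⟨a, ha, fun J hJ => hmem ((he.pos_iff hB J).1 ?_), rfl⟩
    exact add_pos_of_pos_of_nonneg (mul_pos hr hJ) (hb J)

/-- Within the cone of a single nested set coefficients add without cancellation. -/
theorem IsNested.isCoord_add (hB : IsUnionClosed B) (hN : IsNested B N) {c d : S → ℝ}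
    (hc : IsCoord Δ c) (hd : IsCoord Δ d) (hcN : nestedSupport B c ⊆ N)
    (hdN : nestedSupport B d ⊆ N) :
    IsCoord Δ (c + d) ∧ nestedSupport B (c + d) = nestedSupport B c ∪ nestedSupport B d := by
  obtain ⟨a, ha, rfl⟩ := hB.exists_expand hc
  obtain ⟨b, hb, rfl⟩ := hB.exists_expand hd
  have hor : ∀ J, 0 < a J + b J ↔ 0 < a J ∨ 0 < b J := fun J => by
    rcases (ha.nonneg J).eq_or_lt with h | h
    · simp [← h]
    · simp [h, add_pos_of_pos_of_nonneg h (hb.nonneg J)]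
  have hab : IsNestedCoeff B fun J => a J + b J :=
    hN.isNestedCoeff (fun J => add_nonneg (ha.nonneg J) (hb.nonneg J)) fun J hJ =>
      ((hor J).1 hJ).elim (fun h => hcN ((ha.pos_iff hB J).1 h))
        fun h => hdN ((hb.pos_iff hB J).1 h)
  have heq : expand a + expand b = expand fun J => a J + b J :=
    funext fun s => (expand_add a b s).symm
  rw [heq]
  refine ⟨hab.isCoord, Set.ext fun J => ?_⟩
  rw [← hab.pos_iff hB, hor, Set.mem_union, ha.pos_iff hB, hb.pos_iff hB]

theorem iInf_nestedCone_nestedSupport [Nonempty S] (hv : NonDegenerate Δ v)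
    (hB : IsUnionClosed B) {y₀ : S → ℝ} (hy₀ : IsCoord Δ y₀) :
    ⨅ I : B, nestedCone v (nestedSupport (singleFaceSet (I : Face Δ)) y₀) =
      nestedCone v (nestedSupport B y₀) := by
  have hBI := isUnionClosed_singleFaceSet_of_mem hB
  have hiff : ∀ y, IsCoord Δ y → (point v y ∈ nestedCone v (nestedSupport B y₀) ↔
      ∀ I : B, point v y ∈ nestedCone v (nestedSupport (singleFaceSet (I : Face Δ)) y₀)) := by
    intro y hy
    rw [hv.point_mem_nestedCone_iff hB (hB.nestedSupport_isNested hy₀) hy,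
      hB.nestedSupport_subset_iff hy hy₀, dominated_iff_forall_singleFaceSet hB, Subtype.forall']
    refine forall_congr' fun I => ?_
    rw [hv.point_mem_nestedCone_iff (hBI I) ((hBI I).nestedSupport_isNested hy₀) hy,
      (hBI I).nestedSupport_subset_iff hy hy₀]
  ext x
  rw [Submodule.mem_iInf]
  constructor
  · intro h
    obtain ⟨s⟩ := ‹Nonempty S›
    obtain ⟨y, hy, rfl⟩ := ((hBI _).nestedSupport_isNested hy₀).exists_coord_of_mem
      (h ⟨_, hB.single_mem s⟩)
    exact (hiff y hy).2 h
  · intro h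
    obtain ⟨y, hy, rfl⟩ := (hB.nestedSupport_isNested hy₀).exists_coord_of_mem h
    exact (hiff y hy).1 h

theorem nestedFan_eq_coarsestCommonRefinement [Nonempty S] (hv : NonDegenerate Δ v)
    (hB : IsUnionClosed B) :
    nestedFan v B =
      coarsestCommonRefinement fun I : B => nestedFan v (singleFaceSet (I : Face Δ)) := by
  have hBI := isUnionClosed_singleFaceSet_of_mem hB
  ext C
  constructor
  · rw [nestedFan_eq hB]
    rintro ⟨N, hN, rfl⟩
    obtain ⟨y₀, hy₀, rfl⟩ := hN.exists_nestedSupport_eq hB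
    refine ⟨fun I => nestedCone v (nestedSupport (singleFaceSet (I : Face Δ)) y₀), fun I => ?_,
      (iInf_nestedCone_nestedSupport hv hB hy₀).symm⟩
    beta_reduce
    rw [nestedFan_eq (hBI I)]
    exact ⟨_, (hBI I).nestedSupport_isNested hy₀, rfl⟩
  · rintro ⟨K, hK, rfl⟩
    have hK' : ∀ I : B, ∃ N, IsNested (singleFaceSet (I : Face Δ)) N ∧ K I = nestedCone v N :=
      fun I => by
        have := hK I
        beta_reduce at this
        rwa [nestedFan_eq (hBI I)] at this
    choose N hN hKN using hK'
    let Y : Set (S → ℝ) := {y | IsCoord Δ y ∧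
      ∀ I : B, nestedSupport (singleFaceSet (I : Face Δ)) y ⊆ N I}
    have hmem : ∀ y, IsCoord Δ y → (point v y ∈ ⨅ I, K I ↔ y ∈ Y) := by
      intro y hy
      rw [Submodule.mem_iInf]
      refine ⟨fun h => ⟨hy, fun I => ?_⟩, fun h I => ?_⟩
      · have := h I
        rwa [hKN, hv.point_mem_nestedCone_iff (hBI I) (hN I) hy] at this
      · rw [hKN, hv.point_mem_nestedCone_iff (hBI I) (hN I) hy]
        exact h.2 I
    have hmemY : ∀ x ∈ ⨅ I, K I, ∃ y ∈ Y, x = point v y := by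
      intro x hx
      obtain ⟨s⟩ := ‹Nonempty S›
      have h1 := (Submodule.mem_iInf _).1 hx ⟨_, hB.single_mem s⟩
      rw [hKN] at h1
      obtain ⟨y, hy, rfl⟩ := (hN _).exists_coord_of_mem h1
      exact ⟨y, (hmem y hy).1 hx, rfl⟩
    let F : (S → ℝ) → B → Set (Face Δ) := fun y I => nestedSupport (singleFaceSet (I : Face Δ)) y
    obtain ⟨y₁, hy₁, -⟩ := hmemY 0 (Submodule.zero_mem _)
    -- A `y₀` with maximal family of supports acts as a relative interior point of the intersection:
    -- adding any `y ∈ Y` would enlarge the supports to unions, so those of `y` are already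
    -- contained in those of `y₀`.
    obtain ⟨_, -, hm⟩ := (Set.toFinite (F '' Y)).exists_le_maximal ⟨y₁, hy₁, rfl⟩
    obtain ⟨y₀, hy₀, rfl⟩ := hm.1
    have hdom : ∀ y ∈ Y, ∀ I, F y I ⊆ F y₀ I := by
      intro y hy I
      have hadd : ∀ I : B, IsCoord Δ (y₀ + y) ∧ F (y₀ + y) I = F y₀ I ∪ F y I := fun I =>
        (hN I).isCoord_add (hBI I) hy₀.1 hy.1 (hy₀.2 I) (hy.2 I)
      have hY : y₀ + y ∈ Y := ⟨(hadd I).1, fun I => by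
        have := (hadd I).2
        simp only [F] at this
        rw [this]
        exact Set.union_subset (hy₀.2 I) (hy.2 I)⟩
      have hle := hm.2 ⟨_, hY, rfl⟩ (fun I => (hadd I).2 ▸ Set.subset_union_left) I
      exact Set.Subset.trans ((hadd I).2 ▸ Set.subset_union_right) hle
    rw [nestedFan_eq hB]
    refine ⟨_, hB.nestedSupport_isNested hy₀.1, ?_⟩
    rw [← iInf_nestedCone_nestedSupport hv hB hy₀.1]
    refine le_antisymm (fun x hx => ?_) (iInf_mono fun I => ?_)
    · obtain ⟨y, hy, rfl⟩ := hmemY x hx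
      refine (Submodule.mem_iInf _).2 fun I => ?_
      rw [hv.point_mem_nestedCone_iff (hBI I) ((hBI I).nestedSupport_isNested hy₀.1) hy.1]
      exact hdom y hy I
    · rw [hKN]
      exact Submodule.span_mono (Set.image_mono (hy₀.2 I))

/-- Domination for `B'` implies domination for `B`, so the cone of `B` around a point contains the
cone of `B'` around it. -/
theorem nestedFan_coarsens (hv : NonDegenerate Δ v) (hB : IsUnionClosed B) {B' : Set (Face Δ)}
    (hB' : IsUnionClosed B') (hBB' : B ⊆ B') :
    Coarsens (nestedFan v B) (nestedFan v B') := by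
  have hle : ∀ {y y₀}, IsCoord Δ y → IsCoord Δ y₀ → nestedSupport B' y ⊆ nestedSupport B' y₀ →
      nestedSupport B y ⊆ nestedSupport B y₀ := fun hy hy₀ h =>
    (hB.nestedSupport_subset_iff hy hy₀).2
      (((hB'.nestedSupport_subset_iff hy hy₀).1 h).mono hBB')
  rw [nestedFan_eq hB, nestedFan_eq hB']
  constructor
  · rintro _ ⟨M, hM, rfl⟩
    obtain ⟨y₀, hy₀, rfl⟩ := hM.exists_nestedSupport_eq hB'
    refine ⟨_, ⟨_, hB.nestedSupport_isNested hy₀, rfl⟩, ?_⟩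
    rw [nestedCone_le_iff hv hB' hM]
    intro c hc h
    rw [hv.point_mem_nestedCone_iff hB (hB.nestedSupport_isNested hy₀) hc]
    exact hle hc hy₀ h
  · rintro _ ⟨N, hN, rfl⟩
    refine ⟨{C | (∃ M, IsNested B' M ∧ C = nestedCone v M) ∧ C ≤ nestedCone v N},
      fun C hC => hC.1, Set.Subset.antisymm (fun x hx => ?_) ?_⟩
    · obtain ⟨y, hy, rfl⟩ := hN.exists_coord_of_mem hx
      have hyN := hB'.nestedSupport_isNested hy
      refine Set.mem_iUnion₂.2 ⟨nestedCone v (nestedSupport B' y), ⟨⟨_, hyN, rfl⟩, ?_⟩,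
        (hv.point_mem_nestedCone_iff hB' hyN hy).2 subset_rfl⟩
      rw [nestedCone_le_iff hv hB' hyN]
      intro c hc h
      rw [hv.point_mem_nestedCone_iff hB hN hc]
      exact (hle hc hy h).trans ((hv.point_mem_nestedCone_iff hB hN hy).1 hx)
    · exact Set.iUnion₂_subset fun C hC => hC.2

end NonDegenerate

/-! ### Fourier–Motzkin elimination and images of polyhedra -/

section LinearInequalities

variable {V W : Type*} [AddCommGroup V] [Module ℝ V] [AddCommGroup W] [Module ℝ W]

/-- The solution set of finitely many linear inequalities, given by linear functionals. -/
def IsLinPoly (P : Set V) : Prop :=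
  ∃ A : Set ((V →ₗ[ℝ] ℝ) × ℝ), A.Finite ∧ P = {x | ∀ p ∈ A, p.1 x ≤ p.2}

theorem exists_between_of_finite {L U : Set ℝ} (hL : L.Finite) (hU : U.Finite)
    (h : ∀ l ∈ L, ∀ u ∈ U, l ≤ u) : ∃ t, (∀ l ∈ L, l ≤ t) ∧ ∀ u ∈ U, t ≤ u := by
  rcases L.eq_empty_or_nonempty with rfl | hne
  · obtain ⟨t, ht⟩ := hU.bddBelow
    exact ⟨t, by simp, fun u hu => ht hu⟩
  · obtain ⟨t, ht, hmax⟩ := Set.exists_max_image L id hL hne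
    exact ⟨t, hmax, fun u hu => h t ht u hu⟩

/-- Fourier–Motzkin elimination. -/
theorem IsLinPoly.add_line {P : Set V} (hP : IsLinPoly P) (d : V) :
    IsLinPoly {x | ∃ t : ℝ, x + t • d ∈ P} := by
  obtain ⟨A, hA, rfl⟩ := hP
  let pos := {p ∈ A | 0 < p.1 d}
  let neg := {p ∈ A | p.1 d < 0}
  have hpos : pos.Finite := hA.subset fun p hp => hp.1
  have hneg : neg.Finite := hA.subset fun p hp => hp.1
  refine ⟨{p ∈ A | p.1 d = 0} ∪ Set.image2 (fun p q => ((p.1 d) • q.1 - (q.1 d) • p.1,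
    (p.1 d) * q.2 - (q.1 d) * p.2)) pos neg,
    (hA.subset fun p hp => hp.1).union (hpos.image2 _ hneg), ?_⟩
  ext x
  constructor
  · rintro ⟨t, ht⟩ r (hr | ⟨p, hp, q, hq, rfl⟩)
    · have := ht r hr.1
      rwa [map_add, map_smul, hr.2, smul_zero, add_zero] at this
    · have h1 := ht p hp.1
      have h2 := ht q hq.1
      have hp' : 0 < p.1 d := hp.2
      have hq' : q.1 d < 0 := hq.2
      simp only [map_add, map_smul, smul_eq_mul] at h1 h2
      simp only [LinearMap.sub_apply, LinearMap.smul_apply, smul_eq_mul]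
      nlinarith [mul_le_mul_of_nonneg_left h2 hp'.le, mul_le_mul_of_nonpos_left h1 hq'.le]
  · intro hx
    obtain ⟨t, htl, htu⟩ := exists_between_of_finite
      (hneg.image fun q => (q.2 - q.1 x) / q.1 d) (hpos.image fun p => (p.2 - p.1 x) / p.1 d) (by
        rintro _ ⟨q, hq, rfl⟩ _ ⟨p, hp, rfl⟩
        have h := hx _ (Or.inr ⟨p, hp, q, hq, rfl⟩)
        have hp' : 0 < p.1 d := hp.2
        have hq' : q.1 d < 0 := hq.2
        simp only [LinearMap.sub_apply, LinearMap.smul_apply, smul_eq_mul] at h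
        rw [div_le_iff_of_neg hq', div_mul_eq_mul_div, div_le_iff₀ hp']
        linarith)
    refine ⟨t, fun p hp => ?_⟩
    rw [map_add, map_smul, smul_eq_mul]
    rcases lt_trichotomy (p.1 d) 0 with h | h | h
    · have := htl _ ⟨p, ⟨hp, h⟩, rfl⟩
      rw [div_le_iff_of_neg h] at this
      linarith
    · have := hx p (Or.inl ⟨hp, h⟩)
      rw [h]
      linarith
    · have := htu _ ⟨p, ⟨hp, h⟩, rfl⟩
      rw [le_div_iff₀ h] at this
      linarith

theorem IsLinPoly.add_span {P : Set V} (hP : IsLinPoly P) (T : Finset V) :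
    IsLinPoly {x | ∃ y ∈ Submodule.span ℝ (T : Set V), x + y ∈ P} := by
  classical
  induction T using Finset.induction_on with
  | empty => simpa using hP
  | insert d T _ ih =>
    convert ih.add_line d using 1
    ext x
    rw [Finset.coe_insert]
    constructor
    · rintro ⟨y, hy, hxy⟩
      obtain ⟨t, z, hz, rfl⟩ := Submodule.mem_span_insert.1 hy
      exact ⟨t, z, hz, by rwa [add_assoc]⟩
    · rintro ⟨t, z, hz, hxz⟩
      exact ⟨t • d + z, Submodule.mem_span_insert.2 ⟨t, z, hz, rfl⟩, by rwa [← add_assoc]⟩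

theorem IsLinPoly.preimage {P : Set W} (hP : IsLinPoly P) (f : V →ₗ[ℝ] W) :
    IsLinPoly (f ⁻¹' P) := by
  obtain ⟨A, hA, rfl⟩ := hP
  refine ⟨(fun p => (p.1 ∘ₗ f, p.2)) '' A, hA.image _, ?_⟩
  ext x
  exact ⟨by rintro h _ ⟨p, hp, rfl⟩; exact h p hp, fun h p hp => h _ ⟨p, hp, rfl⟩⟩

theorem IsLinPoly.inter {P Q : Set V} (hP : IsLinPoly P) (hQ : IsLinPoly Q) :
    IsLinPoly (P ∩ Q) := by
  obtain ⟨A, hA, rfl⟩ := hP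
  obtain ⟨B, hB, rfl⟩ := hQ
  refine ⟨A ∪ B, hA.union hB, ?_⟩
  ext x
  simp only [Set.mem_inter_iff, Set.mem_ofPred_eq, Set.mem_union, or_imp, forall_and]

theorem isLinPoly_zero [FiniteDimensional ℝ W] : IsLinPoly ({0} : Set W) := by
  let b := Module.finBasis ℝ W
  refine ⟨Set.range (fun i => (b.coord i, (0 : ℝ))) ∪ Set.range fun i => (-b.coord i, (0 : ℝ)),
    (Set.finite_range _).union (Set.finite_range _), ?_⟩
  ext x
  constructor
  · rintro rfl p (⟨i, rfl⟩ | ⟨i, rfl⟩) <;> simp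
  · intro h
    refine b.ext_elem fun i => ?_
    have h1 := h _ (Or.inl ⟨i, rfl⟩)
    have h2 := h _ (Or.inr ⟨i, rfl⟩)
    simp only [Module.Basis.coord_apply, LinearMap.neg_apply] at h1 h2
    rw [map_zero, Finsupp.zero_apply]
    linarith

/-- Linear images of polyhedra are polyhedra. -/
theorem IsLinPoly.image [FiniteDimensional ℝ V] [FiniteDimensional ℝ W] {P : Set V}
    (hP : IsLinPoly P) (f : V →ₗ[ℝ] W) : IsLinPoly (f '' P) := by
  -- The graph of `f` over `P`, saturated in the direction of `V` and sliced at first coordinate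
  -- `0`, is the image.
  have hG : IsLinPoly {z : V × W | z.1 ∈ P ∧ f z.1 - z.2 = 0} :=
    (hP.preimage (LinearMap.fst ℝ V W)).inter
      (isLinPoly_zero.preimage (f ∘ₗ LinearMap.fst ℝ V W - LinearMap.snd ℝ V W))
  obtain ⟨T, hT⟩ := (IsNoetherian.noetherian (LinearMap.range (LinearMap.inl ℝ V W)))
  convert (hG.add_span T).preimage (LinearMap.inr ℝ V W) using 1
  ext w
  simp only [hT, Set.mem_preimage, Set.mem_ofPred_eq, Set.mem_image]
  constructor
  · rintro ⟨x, hx, rfl⟩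
    exact ⟨(x, 0), ⟨x, rfl⟩, by simpa using hx, by simp⟩
  · rintro ⟨_, ⟨x, rfl⟩, hx, hxw⟩
    exact ⟨x, by simpa using hx, by simpa [sub_eq_zero] using hxw⟩

theorem IsLinPoly.add [FiniteDimensional ℝ V] {P Q : Set V} (hP : IsLinPoly P)
    (hQ : IsLinPoly Q) : IsLinPoly (P + Q) := by
  convert ((hP.preimage (LinearMap.fst ℝ V V)).inter (hQ.preimage (LinearMap.snd ℝ V V))).image
    (LinearMap.fst ℝ V V + LinearMap.snd ℝ V V) using 1
  ext x
  simp only [Set.mem_add, Set.mem_image, Set.mem_inter_iff, Set.mem_preimage, Prod.exists,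
    LinearMap.add_apply, LinearMap.fst_apply, LinearMap.snd_apply]
  exact ⟨fun ⟨a, ha, b, hb, h⟩ => ⟨a, b, ⟨ha, hb⟩, h⟩, fun ⟨a, b, ⟨ha, hb⟩, h⟩ => ⟨a, ha, b, hb, h⟩⟩

theorem isLinPoly_sum [FiniteDimensional ℝ V] {ι : Type*} (B : Finset ι) {P : ι → Set V}
    (h : ∀ i ∈ B, IsLinPoly (P i)) : IsLinPoly (∑ i ∈ B, P i) := by
  classical
  induction B using Finset.induction_on with
  | empty => rw [Finset.sum_empty]; exact isLinPoly_zero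
  | insert i B hi ih =>
    rw [Finset.sum_insert hi]
    exact (h i (Finset.mem_insert_self _ _)).add (ih fun j hj => h j (Finset.mem_insert_of_mem hj))

/-- The image in `ℝ` is again a polyhedron, hence closed, so a finite supremum is attained without
any compactness. -/
theorem IsLinPoly.exists_isMax {P : Set V} [FiniteDimensional ℝ V] (hP : IsLinPoly P)
    (hne : P.Nonempty) (f : V →ₗ[ℝ] ℝ) {β : ℝ} (hβ : ∀ x ∈ P, f x ≤ β) :
    ∃ x ∈ P, ∀ y ∈ P, f y ≤ f x := by
  obtain ⟨A, -, hA⟩ := hP.image f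
  have hclosed : IsClosed (f '' P) := by
    have : f '' P = ⋂ p ∈ A, {t : ℝ | p.1 t ≤ p.2} := by
      rw [hA]; ext; simp
    rw [this]
    refine isClosed_biInter fun p _ => isClosed_le ?_ continuous_const
    exact LinearMap.continuous_of_finiteDimensional p.1
  have hbdd : BddAbove (f '' P) := ⟨β, by rintro _ ⟨x, hx, rfl⟩; exact hβ x hx⟩
  obtain ⟨x, hx, hxs⟩ := hclosed.csSup_mem (hne.image f) hbdd
  exact ⟨x, hx, fun y hy => hxs ▸ le_csSup hbdd ⟨y, hy, rfl⟩⟩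

end LinearInequalities

/-! ### Polyhedra in inner product spaces and Farkas' lemma -/

section InnerProduct

variable {E : Type*} [NormedAddCommGroup E] [InnerProductSpace ℝ E] [FiniteDimensional ℝ E]

theorem exists_inner_eq (f : E →ₗ[ℝ] ℝ) : ∃ a : E, ∀ x, f x = inner ℝ a x :=
  ⟨(InnerProductSpace.toDual ℝ E).symm (LinearMap.toContinuousLinearMap f), fun x => by simp⟩

theorem isPolyhedron_iff_isLinPoly {P : Set E} : IsPolyhedron P ↔ IsLinPoly P := by
  classical
  constructor
  · rintro ⟨A, rfl⟩
    refine ⟨(fun p : E × ℝ => ((innerSL ℝ p.1 : E →L[ℝ] ℝ).toLinearMap, p.2)) '' A,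
      A.finite_toSet.image _, ?_⟩
    ext x
    exact ⟨by rintro h _ ⟨p, hp, rfl⟩; exact h p hp, fun h p hp => h _ ⟨p, hp, rfl⟩⟩
  · rintro ⟨A, hA, rfl⟩
    choose g hg using fun f : E →ₗ[ℝ] ℝ => exists_inner_eq f
    refine ⟨hA.toFinset.image fun p => (g p.1, p.2), ?_⟩
    ext x
    simp only [Set.mem_ofPred_eq, Finset.forall_mem_image, Set.Finite.mem_toFinset, hg]

theorem IsPolyhedron.exists_isMax {P : Set E} (hP : IsPolyhedron P) (hne : P.Nonempty) (a : E)
    {β : ℝ} (hβ : ∀ x ∈ P, inner ℝ a x ≤ β) : ∃ x ∈ P, ∀ y ∈ P, inner ℝ a y ≤ inner ℝ a x :=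
  (isPolyhedron_iff_isLinPoly.1 hP).exists_isMax hne (innerSL ℝ a : E →L[ℝ] ℝ).toLinearMap hβ

/-- Farkas' lemma. -/
theorem exists_nonneg_combination {ι : Type*} [Fintype ι] (p : ι → E) (g : E)
    (h : ∀ d, (∀ i, inner ℝ (p i) d ≤ 0) → inner ℝ g d ≤ 0) :
    ∃ c : ι → ℝ, (∀ i, 0 ≤ c i) ∧ g = ∑ i, c i • p i := by
  have horth : IsLinPoly {c : ι → ℝ | ∀ i, 0 ≤ c i} := by
    refine ⟨Set.range fun i => (-LinearMap.proj i, 0), Set.finite_range _, ?_⟩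
    ext c
    simp
  -- The cone is a linear image of the orthant, so a point outside violates one of finitely many
  -- inequalities, which then serves as separator.
  have hcone : IsPolyhedron ((Fintype.linearCombination ℝ p) '' {c : ι → ℝ | ∀ i, 0 ≤ c i}) :=
    isPolyhedron_iff_isLinPoly.2 (horth.image _)
  obtain ⟨A, hA⟩ := hcone
  by_contra hcon
  have hg : g ∉ (Fintype.linearCombination ℝ p) '' {c : ι → ℝ | ∀ i, 0 ≤ c i} := by
    rintro ⟨c, hc, rfl⟩
    exact hcon ⟨c, hc, Fintype.linearCombination_apply ℝ p c⟩
  have hmem : ∀ c : ι → ℝ, (∀ i, 0 ≤ c i) → ∀ q ∈ A, inner ℝ q.1 (∑ i, c i • p i) ≤ q.2 := by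
    intro c hc
    have : Fintype.linearCombination ℝ p c ∈
      (Fintype.linearCombination ℝ p) '' {c : ι → ℝ | ∀ i, 0 ≤ c i} := ⟨c, hc, rfl⟩
    rw [hA, Fintype.linearCombination_apply] at this
    exact this
  rw [hA] at hg
  simp only [Set.mem_ofPred_eq, not_forall, not_le] at hg
  obtain ⟨q, hq, hgq⟩ := hg
  have hq0 : 0 ≤ q.2 := by simpa using hmem 0 (fun _ => le_rfl) q hq
  have := h q.1 fun i => by
    classical
    by_contra! hpos
    rw [real_inner_comm] at hpos
    -- If `p i` had positive product with `q.1`, this multiple of it would reach the value `q.2 + 1`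
    -- inside the cone.
    have h1 := hmem (Pi.single i ((q.2 + 1) / inner ℝ q.1 (p i))) (fun j => by
      rw [Pi.single_apply]
      split_ifs
      · positivity
      · exact le_rfl) q hq
    rw [Finset.sum_eq_single i (fun j _ hj => by simp [hj]) (by simp), Pi.single_eq_same,
      inner_smul_right, div_mul_cancel₀ _ hpos.ne'] at h1
    linarith
  rw [real_inner_comm] at this
  linarith

end InnerProduct

/-! ### Faces, tight sets and simple descriptions by inequalities -/

section HalfspaceDescription

variable {E : Type*} [NormedAddCommGroup E] [InnerProductSpace ℝ E] {ι : Type*}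

/-- The polyhedron `{x | ⟪w i, x⟫ ≤ h i for all i}`. -/
def hPoly (w : ι → E) (h : ι → ℝ) : Set E := {x | ∀ i, inner ℝ (w i) x ≤ h i}

/-- The set of inequalities which hold with equality at `x`. -/
def tight (w : ι → E) (h : ι → ℝ) (x : E) : Set ι := {i | inner ℝ (w i) x = h i}

/-- The face of `hPoly w h` where the inequalities in `N` hold with equality. -/
def hFace (w : ι → E) (h : ι → ℝ) (N : Set ι) : Set E := {x ∈ hPoly w h | N ⊆ tight w h x}

variable {w : ι → E} {h : ι → ℝ}

theorem isPolyhedron_hFace [Finite ι] (N : Set ι) : IsPolyhedron (hFace w h N) := by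
  classical
  cases nonempty_fintype ι
  refine ⟨Finset.univ.image (fun i => (w i, h i)) ∪
    (Finset.univ.filter (· ∈ N)).image fun i => (-w i, -h i), ?_⟩
  ext x
  constructor
  · rintro ⟨hx, hN⟩ p hp
    rcases Finset.mem_union.1 hp with hp | hp
    · obtain ⟨i, -, rfl⟩ := Finset.mem_image.1 hp
      exact hx i
    · obtain ⟨i, hi, rfl⟩ := Finset.mem_image.1 hp
      have : inner ℝ (w i) x = h i := hN (Finset.mem_filter.1 hi).2
      simp [this]
  · intro hx
    have h1 : x ∈ hPoly w h := fun i => hx (w i, h i)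
      (Finset.mem_union_left _ (Finset.mem_image_of_mem _ (Finset.mem_univ i)))
    refine ⟨h1, fun i hi => le_antisymm (h1 i) ?_⟩
    have := hx (-w i, -h i) (Finset.mem_union_right _ (Finset.mem_image.2 ⟨i, by simpa using hi, rfl⟩))
    simpa using this

theorem hFace_empty : hFace w h ∅ = hPoly w h := by
  ext x
  exact ⟨fun hx => hx.1, fun hx => ⟨hx, Set.empty_subset _⟩⟩

theorem isPolyhedron_hPoly [Finite ι] : IsPolyhedron (hPoly w h) :=
  hFace_empty (w := w) (h := h) ▸ isPolyhedron_hFace ∅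

theorem convex_hPoly : Convex ℝ (hPoly w h) := by
  intro x hx y hy a b ha hb hab i
  rw [inner_add_right, inner_smul_right, inner_smul_right]
  have h1 := mul_le_mul_of_nonneg_left (hx i) ha
  have h2 := mul_le_mul_of_nonneg_left (hy i) hb
  calc _ ≤ a * h i + b * h i := add_le_add h1 h2
    _ = h i := by rw [← add_mul, hab, one_mul]

open Filter Topology in
/-- From a point of a polyhedron one can move a little in any direction allowed by the tight
inequalities. -/
theorem exists_move [Finite ι] {x d : E} (hx : x ∈ hPoly w h)
    (hd : ∀ i ∈ tight w h x, inner ℝ (w i) d ≤ 0) :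
    ∃ ε : ℝ, 0 < ε ∧ x + ε • d ∈ hPoly w h ∧
      tight w h (x + ε • d) = {i ∈ tight w h x | inner ℝ (w i) d = 0} := by
  have hev : ∀ᶠ ε : ℝ in 𝓝[>] 0, ∀ i, i ∉ tight w h x →
      inner ℝ (w i) x + ε * inner ℝ (w i) d < h i := by
    refine eventually_all.2 fun i => ?_
    by_cases hi : i ∈ tight w h x
    · exact Eventually.of_forall fun _ h => absurd hi h
    · have hlt : inner ℝ (w i) x + 0 * inner ℝ (w i) d < h i := by
        rw [zero_mul, add_zero]
        exact lt_of_le_of_ne (hx i) hi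
      have hc : Continuous fun ε : ℝ => inner ℝ (w i) x + ε * inner ℝ (w i) d := by fun_prop
      filter_upwards [nhdsWithin_le_nhds (hc.continuousAt.eventually_lt_const hlt)] with ε hε _
      exact hε
  obtain ⟨ε, hε, hpos⟩ := (hev.and self_mem_nhdsWithin).exists
  have hpos : 0 < ε := hpos
  have hexp : ∀ i, inner ℝ (w i) (x + ε • d) = inner ℝ (w i) x + ε * inner ℝ (w i) d := fun i => by
    rw [inner_add_right, inner_smul_right]
  refine ⟨ε, hpos, fun i => ?_, Set.ext fun i => ?_⟩
  · rw [hexp]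
    by_cases hi : i ∈ tight w h x
    · have := mul_nonpos_of_nonneg_of_nonpos hpos.le (hd i hi)
      linarith [hx i]
    · exact (hε i hi).le
  · change inner ℝ (w i) (x + ε • d) = h i ↔ _ ∧ _
    rw [hexp]
    by_cases hi : i ∈ tight w h x
    · have hi' : inner ℝ (w i) x = h i := hi
      simp [hi, hi', hpos.ne']
    · simp [hi, (hε i hi).ne]

/-- An inequality tight at a midpoint is tight at both ends, so a minimal tight set on a convex set
is least. -/
theorem exists_forall_tight_subset [Finite ι] {F : Set E} (hF : F ⊆ hPoly w h)
    (hconv : Convex ℝ F) (hne : F.Nonempty) :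
    ∃ x ∈ F, ∀ y ∈ F, tight w h x ⊆ tight w h y := by
  obtain ⟨x₁, hx₁⟩ := hne
  obtain ⟨_, -, hm⟩ := (Set.toFinite (tight w h '' F)).exists_le_minimal ⟨x₁, hx₁, rfl⟩
  obtain ⟨x, hx, rfl⟩ := hm.1
  refine ⟨x, hx, fun y hy => ?_⟩
  have hz : (1 / 2 : ℝ) • x + (1 / 2 : ℝ) • y ∈ F :=
    hconv hx hy (by norm_num) (by norm_num) (by norm_num)
  have hzt : ∀ i ∈ tight w h ((1 / 2 : ℝ) • x + (1 / 2 : ℝ) • y),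
      i ∈ tight w h x ∧ i ∈ tight w h y := by
    intro i hi
    have hi' : inner ℝ (w i) ((1 / 2 : ℝ) • x + (1 / 2 : ℝ) • y) = h i := hi
    rw [inner_add_right, inner_smul_right, inner_smul_right] at hi'
    have h1 := hF hx i
    have h2 := hF hy i
    exact ⟨le_antisymm h1 (by linarith), le_antisymm h2 (by linarith)⟩
  exact (hm.2 ⟨_, hz, rfl⟩ fun i hi => (hzt i hi).1).trans fun i hi => (hzt i hi).2

theorem exists_eq_hFace_of_isExposed [Finite ι] {F : Set E} (hF : IsExposed ℝ (hPoly w h) F)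
    (hne : F.Nonempty) : ∃ x ∈ F, F = hFace w h (tight w h x) := by
  obtain ⟨x, hx, hmin⟩ := exists_forall_tight_subset hF.subset (hF.convex convex_hPoly) hne
  refine ⟨x, hx, Set.Subset.antisymm (fun y hy => ⟨hF.subset hy, hmin y hy⟩) ?_⟩
  rintro y ⟨hy, hxy⟩
  obtain ⟨l, hl⟩ := hF hne
  have hx' := hx
  rw [hl] at hx' ⊢
  refine ⟨hy, fun z hz => (hx'.2 z hz).trans ?_⟩
  -- Everything tight at `x` is tight at `y`, so the segment from `y` extends beyond `x`; the
  -- maximum at `x` is therefore also attained at `y`.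
  obtain ⟨ε, hε, hmem, -⟩ := exists_move (d := x - y) hx'.1 fun i hi => by
    have h1 : inner ℝ (w i) x = h i := hi
    have h2 : inner ℝ (w i) y = h i := hxy hi
    rw [inner_sub_right, h1, h2, sub_self]
  have := hx'.2 _ hmem
  rw [map_add, map_smul, map_sub, smul_eq_mul] at this
  by_contra! hlt
  have := mul_pos hε (sub_pos.2 hlt)
  linarith

/-- The sum of the normals in `N` exposes the face. -/
theorem isExposed_hFace [Finite ι] (N : Set ι) : IsExposed ℝ (hPoly w h) (hFace w h N) := by
  rintro ⟨x₀, hx₀, hN⟩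
  let T := N.toFinite.toFinset
  have hT : ∀ i, i ∈ T ↔ i ∈ N := fun i => N.toFinite.mem_toFinset
  have hle : ∀ y ∈ hPoly w h, ∑ i ∈ T, inner ℝ (w i) y ≤ ∑ i ∈ T, h i := fun y hy =>
    Finset.sum_le_sum fun i _ => hy i
  have heq : ∀ y, N ⊆ tight w h y → ∑ i ∈ T, inner ℝ (w i) y = ∑ i ∈ T, h i := fun y hy =>
    Finset.sum_congr rfl fun i hi => hy ((hT i).1 hi)
  refine ⟨innerSL ℝ (∑ i ∈ T, w i), Set.ext fun x => ?_⟩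
  simp only [innerSL_apply_apply, sum_inner, Set.mem_ofPred_eq, hFace]
  refine and_congr_right fun hx => ⟨fun hNx y hy => (heq x hNx).symm ▸ hle y hy, fun hmax i hi => ?_⟩
  have h1 := hmax x₀ hx₀
  rw [heq x₀ hN] at h1
  exact (Finset.sum_eq_sum_iff_of_le fun i _ => hx i).1 (le_antisymm (hle x hx) h1) i ((hT i).2 hi)

theorem vectorSpan_hFace [Finite ι] {x : E} (hx : x ∈ hPoly w h) :
    vectorSpan ℝ (hFace w h (tight w h x)) = (Submodule.span ℝ (w '' tight w h x))ᗮ := by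
  apply le_antisymm
  · rw [vectorSpan_def, Submodule.span_le]
    rintro _ ⟨y, hy, z, hz, rfl⟩
    refine (Submodule.mem_orthogonal _ _).2 fun u hu => ?_
    induction hu using Submodule.span_induction with
    | mem u hu =>
      obtain ⟨i, hi, rfl⟩ := hu
      have h1 : inner ℝ (w i) y = h i := hy.2 hi
      have h2 : inner ℝ (w i) z = h i := hz.2 hi
      simp [inner_sub_right, h1, h2]
    | zero => simp
    | add a b _ _ ha hb => rw [inner_add_left, ha, hb, add_zero]
    | smul r a _ ha => rw [inner_smul_left, ha, mul_zero]
  · intro d hd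
    have hd0 : ∀ i ∈ tight w h x, inner ℝ (w i) d = 0 := fun i hi =>
      (Submodule.mem_orthogonal _ _).1 hd _ (Submodule.subset_span ⟨i, hi, rfl⟩)
    obtain ⟨ε, hε, hmem, ht⟩ := exists_move hx fun i hi => (hd0 i hi).le
    have hsub : tight w h x ⊆ tight w h (x + ε • d) := fun i hi => ht ▸ ⟨hi, hd0 i hi⟩
    have := vsub_mem_vectorSpan ℝ (s := hFace w h (tight w h x)) (p₁ := x + ε • d) (p₂ := x)
      ⟨hmem, hsub⟩ ⟨hx, subset_rfl⟩
    rw [vsub_eq_sub, add_sub_cancel_left] at this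
    exact (Submodule.smul_mem_iff _ hε.ne').1 this

theorem finrank_vectorSpan_hFace [FiniteDimensional ℝ E] [Finite ι] {x : E}
    (hx : x ∈ hPoly w h) :
    Module.finrank ℝ (Submodule.span ℝ (w '' tight w h x)) +
      Module.finrank ℝ (vectorSpan ℝ (hFace w h (tight w h x))) = Module.finrank ℝ E := by
  rw [vectorSpan_hFace hx]
  exact Submodule.finrank_add_finrank_orthogonal _

/-- A description by inequalities in which the tight inequalities at every point are independent,
and every inequality is tight somewhere. -/
structure IsSimpleData (w : ι → E) (h : ι → ℝ) : Prop where
  nonempty : (hPoly w h).Nonempty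
  indep : ∀ x ∈ hPoly w h, LinearIndepOn ℝ w (tight w h x)
  touch : ∀ i, ∃ x ∈ hPoly w h, i ∈ tight w h x

theorem finrank_span_image [Finite ι] {N : Set ι} (hN : LinearIndepOn ℝ w N) :
    Module.finrank ℝ (Submodule.span ℝ (w '' N)) = N.ncard := by
  have := Fintype.ofFinite N
  have h1 := finrank_span_eq_card (R := ℝ) hN
  rw [← Set.image_eq_range] at h1
  rw [h1, ← Nat.card_eq_fintype_card, Nat.card_coe_set_eq]

/-- Independence of the tight normals allows a direction with product `0` with those in `N` and `-1`
with the others; a small step along it loosens exactly the latter. -/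
theorem exists_tight_eq [FiniteDimensional ℝ E] [Finite ι]
    (hw : ∀ x ∈ hPoly w h, LinearIndepOn ℝ w (tight w h x)) {x : E} (hx : x ∈ hPoly w h)
    {N : Set ι} (hN : N ⊆ tight w h x) : ∃ y ∈ hPoly w h, tight w h y = N := by
  classical
  let b := Module.Basis.span (hw x hx)
  obtain ⟨f, hf⟩ := LinearMap.exists_extend
    (b.constr ℝ fun i : tight w h x => if (i : ι) ∈ N then (0 : ℝ) else -1)
  have hfw : ∀ i (hi : i ∈ tight w h x), f (w i) = if i ∈ N then (0 : ℝ) else -1 := by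
    intro i hi
    have h1 := LinearMap.congr_fun hf (b ⟨i, hi⟩)
    rw [Module.Basis.constr_basis] at h1
    have hb : ((b ⟨i, hi⟩ : Submodule.span ℝ (Set.range fun j : tight w h x => w j)) : E) = w i :=
      congrArg Subtype.val (Module.Basis.span_apply (hw x hx) ⟨i, hi⟩)
    rw [← h1, LinearMap.comp_apply, Submodule.subtype_apply, hb]
  obtain ⟨d, hd⟩ := exists_inner_eq f
  have hdw : ∀ i (hi : i ∈ tight w h x), inner ℝ (w i) d = if i ∈ N then (0 : ℝ) else -1 :=
    fun i hi => by rw [real_inner_comm, ← hd, hfw i hi]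
  obtain ⟨ε, -, hmem, ht⟩ := exists_move (d := d) hx fun i hi => by
    rw [hdw i hi]; split_ifs <;> norm_num
  refine ⟨_, hmem, ht.trans (Set.ext fun i => ⟨fun hi => ?_, fun hi => ⟨hN hi, ?_⟩⟩)⟩
  · have := hi.2
    rw [hdw i hi.1] at this
    by_contra h'
    simp [h'] at this
  · rw [hdw i (hN hi), if_pos hi]

namespace IsSimpleData

variable [FiniteDimensional ℝ E] [Finite ι]

theorem finrank_hFace (hs : IsSimpleData w h) {x : E} (hx : x ∈ hPoly w h) :
    (tight w h x).ncard + Module.finrank ℝ (vectorSpan ℝ (hFace w h (tight w h x))) =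
      Module.finrank ℝ E := by
  rw [← finrank_vectorSpan_hFace hx, finrank_span_image (hs.indep x hx)]

theorem exists_tight_eq_singleton (hs : IsSimpleData w h) (i : ι) : ∃ x ∈ hPoly w h, tight w h x = {i} := by
  obtain ⟨x, hx, hi⟩ := hs.touch i
  exact exists_tight_eq hs.indep hx (Set.singleton_subset_iff.2 hi)

theorem hFace_singleton_mem_facets (hs : IsSimpleData w h) (i : ι) : hFace w h {i} ∈ facets (hPoly w h) := by
  obtain ⟨x, hx, hxi⟩ := hs.exists_tight_eq_singleton i
  refine ⟨isExposed_hFace _, ⟨x, hx, hxi.ge⟩, ?_⟩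
  have := hs.finrank_hFace hx
  rw [hxi, Set.ncard_singleton] at this
  omega

theorem hFace_singleton_injective (hs : IsSimpleData w h) : Function.Injective fun i => hFace w h {i} := by
  intro i j hij
  obtain ⟨x, hx, hxi⟩ := hs.exists_tight_eq_singleton i
  have : x ∈ hFace w h {j} := (Set.ext_iff.1 hij x).1 ⟨hx, hxi.ge⟩
  have hj : j ∈ tight w h x := this.2 rfl
  rw [hxi] at hj
  exact hj.symm

theorem exists_eq_hFace_singleton (hs : IsSimpleData w h) {F : Set E} (hF : F ∈ facets (hPoly w h)) :
    ∃ i, hFace w h {i} = F := by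
  obtain ⟨x, hx, hFx⟩ := exists_eq_hFace_of_isExposed hF.1 hF.2.1
  have h1 := hs.finrank_hFace (hF.1.subset hx)
  have h2 := hF.2.2
  rw [← hFx] at h1
  obtain ⟨i, hi⟩ := Set.ncard_eq_one.1 (show (tight w h x).ncard = 1 by omega)
  exact ⟨i, by rw [hFx, hi]⟩

/-- The inequalities correspond to the facets. -/
noncomputable def facetEquiv (hs : IsSimpleData w h) : ι ≃ facets (hPoly w h) :=
  Equiv.ofBijective (fun i => ⟨hFace w h {i}, hs.hFace_singleton_mem_facets i⟩)
    ⟨fun _ _ hij => hs.hFace_singleton_injective (congrArg Subtype.val hij), fun F => by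
      obtain ⟨i, hi⟩ := hs.exists_eq_hFace_singleton F.2
      exact ⟨i, Subtype.ext hi⟩⟩

theorem mem_facetEquiv (hs : IsSimpleData w h) {x : E} (hx : x ∈ hPoly w h) (i : ι) :
    x ∈ (hs.facetEquiv i : Set E) ↔ i ∈ tight w h x :=
  ⟨fun hxi => hxi.2 rfl, fun hi => ⟨hx, Set.singleton_subset_iff.2 hi⟩⟩

theorem isSimplePolyhedron (hs : IsSimpleData w h) : IsSimplePolyhedron (hPoly w h) := by
  refine ⟨isPolyhedron_hPoly, ?_, fun F hF hne => ?_⟩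
  · obtain ⟨x, hx⟩ := hs.nonempty
    obtain ⟨y, hy, hyt⟩ := exists_tight_eq hs.indep hx (Set.empty_subset _)
    refine ⟨y, mem_interior.2 ⟨⋂ i, {z | inner ℝ (w i) z < h i}, fun z hz i => ?_,
      isOpen_iInter_of_finite fun i => isOpen_lt (by fun_prop) continuous_const, ?_⟩⟩
    · exact (Set.mem_iInter.1 hz i).le
    · refine Set.mem_iInter.2 fun i => lt_of_le_of_ne (hy i) fun heq => ?_
      exact (Set.ext_iff.1 hyt i).1 heq
  · obtain ⟨x, hx, hFx⟩ := exists_eq_hFace_of_isExposed hF hne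
    have hxP := hF.subset hx
    have hset : {G ∈ facets (hPoly w h) | F ⊆ G} = (fun i => hFace w h {i}) '' tight w h x := by
      ext G
      constructor
      · rintro ⟨hG, hFG⟩
        obtain ⟨i, rfl⟩ := hs.exists_eq_hFace_singleton hG
        exact ⟨i, (hFG hx).2 rfl, rfl⟩
      · rintro ⟨i, hi, rfl⟩
        refine ⟨hs.hFace_singleton_mem_facets i, ?_⟩
        rw [hFx]
        exact fun y hy => ⟨hy.1, (Set.singleton_subset_iff.2 hi).trans hy.2⟩
    rw [hset, hs.hFace_singleton_injective.encard_image, ← (Set.toFinite _).cast_ncard_eq,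
      ← hs.finrank_hFace hxP, ← hFx]
    norm_cast

end IsSimpleData

end HalfspaceDescription

/-! ### Recovering a simple description from the facets -/

section FacetDescription

variable {E : Type*} [NormedAddCommGroup E] [InnerProductSpace ℝ E]

theorem finite_exposed_hPoly {ι : Type*} [Finite ι] (w : ι → E) (h : ι → ℝ) :
    {F | IsExposed ℝ (hPoly w h) F ∧ F.Nonempty}.Finite := by
  refine (Set.finite_range (hFace w h)).subset ?_
  rintro F ⟨hF, hne⟩
  obtain ⟨x, -, hx⟩ := exists_eq_hFace_of_isExposed hF hne
  exact ⟨_, hx.symm⟩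

/-- The polyhedron defined by a finite set of inequalities. -/
def finsetPoly (A : Finset (E × ℝ)) : Set E := {x | ∀ p ∈ A, inner ℝ p.1 x ≤ p.2}

theorem finsetPoly_eq_hPoly (A : Finset (E × ℝ)) :
    finsetPoly A = hPoly (fun p : A => p.1.1) fun p => p.1.2 := by
  ext x
  exact ⟨fun hx p => hx p.1 p.2, fun hx p hp => hx ⟨p, hp⟩⟩

theorem IsPolyhedron.finite_exposed {P : Set E} (hP : IsPolyhedron P) :
    {F | IsExposed ℝ P F ∧ F.Nonempty}.Finite := by
  obtain ⟨A, hA⟩ := hP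
  rw [show P = _ from hA.trans (finsetPoly_eq_hPoly A)]
  exact finite_exposed_hPoly _ _

theorem IsPolyhedron.finite_facets {P : Set E} (hP : IsPolyhedron P) : Finite (facets P) :=
  (hP.finite_exposed.subset fun _ hF => ⟨hF.1, hF.2.1⟩).to_subtype

theorem IsPolyhedron.exists_irredundant {P : Set E} (hP : IsPolyhedron P) :
    ∃ A : Finset (E × ℝ), P = finsetPoly A ∧
      ∀ p ∈ A, ∃ x, (∀ q ∈ A, q ≠ p → inner ℝ q.1 x ≤ q.2) ∧ p.2 < inner ℝ p.1 x := by
  classical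
  obtain ⟨A₀, hA₀⟩ := hP
  obtain ⟨A, -, hA⟩ := exists_minimal_le_of_wellFoundedLT (fun A => P = finsetPoly A) A₀ hA₀
  refine ⟨A, hA.1, fun p hp => ?_⟩
  by_contra! hcon
  refine absurd (hA.2 (y := A.erase p) ?_ (Finset.erase_subset _ _) hp)
    (Finset.notMem_erase p A)
  rw [hA.1]
  ext x
  refine ⟨fun hx q hq => hx q (Finset.mem_of_mem_erase hq), fun hx q hq => ?_⟩
  by_cases hqp : q = p
  · rw [hqp]
    exact hcon x fun q hq hne => hx q (Finset.mem_erase.2 ⟨hne, hq⟩)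
  · exact hx q (Finset.mem_erase.2 ⟨hqp, hq⟩)

open Filter Topology in
theorem inner_lt_of_mem_interior {P : Set E} {a x : E} {b : ℝ} (ha : a ≠ 0)
    (hP : ∀ y ∈ P, inner ℝ a y ≤ b) (hx : x ∈ interior P) : inner ℝ a x < b := by
  have hc : ContinuousAt (fun ε : ℝ => x + ε • a) 0 := by fun_prop
  have hev : ∀ᶠ ε : ℝ in 𝓝[>] 0, x + ε • a ∈ P :=
    nhdsWithin_le_nhds (hc.eventually (by simpa using mem_interior_iff_mem_nhds.1 hx))
  obtain ⟨ε, hε, hpos⟩ := (hev.and self_mem_nhdsWithin).exists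
  have hpos : 0 < ε := hpos
  have h1 := hP _ hε
  rw [inner_add_right, inner_smul_right] at h1
  have := mul_pos hpos (real_inner_self_pos.2 ha)
  linarith

variable [FiniteDimensional ℝ E]

/-- Facet-defining inequalities describe a full-dimensional polyhedron. -/
theorem IsPolyhedron.eq_hPoly {P : Set E} (hP : IsPolyhedron P) (hint : (interior P).Nonempty)
    {v : facets P → E} (hv : ∀ s : facets P, maxFace P (v s) = (s : Set E)) {h : facets P → ℝ}
    (hh : ∀ s : facets P, ∀ x ∈ (s : Set E), inner ℝ (v s) x = h s) : P = hPoly v h := by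
  obtain ⟨A, hPA, hirr⟩ := hP.exists_irredundant
  obtain ⟨x₀, hx₀⟩ := hint
  have hx₀P := interior_subset hx₀
  refine Set.Subset.antisymm (fun x hx s => ?_) fun x hx => ?_
  · obtain ⟨z, hz⟩ := s.2.2.1
    rw [← hh s z hz]
    rw [← hv s] at hz
    exact hz.2 x hx
  rw [hPA]
  intro p hp
  obtain ⟨x', hx', hpx'⟩ := hirr p hp
  have hle : ∀ q ∈ A, ∀ y ∈ P, inner ℝ q.1 y ≤ q.2 := fun q hq y hy => by
    rw [hPA] at hy
    exact hy q hq
  have hp0 : p.1 ≠ 0 := by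
    intro h0
    have h1 := hle p hp x₀ hx₀P
    rw [h0, inner_zero_left] at h1 hpx'
    exact hpx'.not_ge h1
  have hlt : ∀ q ∈ A, q.1 ≠ 0 → inner ℝ q.1 x₀ < q.2 := fun q hq hq0 =>
    inner_lt_of_mem_interior hq0 (hle q hq) hx₀
  have hplt := hlt p hp hp0
  -- The segment from the interior point `x₀` to `x'`, which violates only `p`, crosses the
  -- hyperplane of `p` at `y`. There `p` alone is tight, so `p` defines a facet.
  let t := (p.2 - inner ℝ p.1 x₀) / (inner ℝ p.1 x' - inner ℝ p.1 x₀)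
  have hden : 0 < inner ℝ p.1 x' - inner ℝ p.1 x₀ := by linarith
  have ht0 : 0 < t := div_pos (by linarith) hden
  have ht1 : t < 1 := (div_lt_one hden).2 (by linarith)
  let y := x₀ + t • (x' - x₀)
  have hy : ∀ q : E × ℝ, inner ℝ q.1 y = inner ℝ q.1 x₀ + t * (inner ℝ q.1 x' - inner ℝ q.1 x₀) :=
    fun q => by simp only [y, inner_add_right, inner_smul_right, inner_sub_right]
  have hyp : inner ℝ p.1 y = p.2 := by
    rw [hy]
    simp only [t]
    rw [div_mul_cancel₀ _ hden.ne']
    ring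
  have hyq : ∀ q ∈ A, q ≠ p → inner ℝ q.1 y ≤ q.2 ∧ (inner ℝ q.1 y = q.2 → q.1 = 0) := by
    intro q hq hqp
    have h1 := hx' q hq hqp
    have h2 := hle q hq x₀ hx₀P
    have h3 := mul_nonneg ht0.le (sub_nonneg.2 h1)
    refine ⟨?_, fun heq => ?_⟩
    · rw [hy]
      nlinarith
    · by_contra hq0
      have h4 := hlt q hq hq0
      rw [hy] at heq
      nlinarith
  have hA0 : ∀ q ∈ A, q.1 ≠ 0 := by
    intro q hq hq0
    obtain ⟨z, -, hz⟩ := hirr q hq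
    have h1 := hle q hq x₀ hx₀P
    rw [hq0, inner_zero_left] at h1 hz
    exact hz.not_ge h1
  have hyP : y ∈ P := by
    rw [hPA]
    intro q hq
    by_cases hqp : q = p
    · rw [hqp, hyp]
    · exact (hyq q hq hqp).1
  let w : A → E := fun q => q.1.1
  let g : A → ℝ := fun q => q.1.2
  have hPw : P = hPoly w g := hPA.trans (finsetPoly_eq_hPoly A)
  have hyw : y ∈ hPoly w g := hPw ▸ hyP
  have htight : tight w g y = {⟨p, hp⟩} := by
    ext q
    refine ⟨fun hq => ?_, ?_⟩
    · by_contra hne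
      have hne' : q.1 ≠ p := fun h => hne (Subtype.ext h)
      exact hA0 q.1 q.2 ((hyq q.1 q.2 hne').2 hq)
    · rintro rfl
      exact hyp
  have hF : hFace w g (tight w g y) ∈ facets P := by
    refine ⟨hPw ▸ isExposed_hFace _, ⟨y, hyw, subset_rfl⟩, ?_⟩
    rw [← finrank_vectorSpan_hFace hyw, add_comm, htight, Set.image_singleton]
    congr 1
    exact (finrank_span_singleton hp0).symm
  let s : facets P := ⟨_, hF⟩
  have hys : y ∈ (s : Set E) := ⟨hyw, subset_rfl⟩
  have hymax : ∀ z ∈ P, inner ℝ (v s) z ≤ inner ℝ (v s) y := by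
    have := hys
    rw [← hv s] at this
    exact this.2
  -- By Farkas, `v s` is a nonnegative multiple of `p.1`. The multiple is nonzero because `x₀` is
  -- not on the facet.
  obtain ⟨c, hc, hvs⟩ := exists_nonneg_combination (fun _ : Unit => p.1) (v s) fun d hd => by
    obtain ⟨ε, hε, hmem, -⟩ := exists_move (d := d) hyw fun q hq => by
      rw [htight] at hq
      rw [hq]
      exact hd ()
    rw [← hPw] at hmem
    have := hymax _ hmem
    rw [inner_add_right, inner_smul_right] at this
    by_contra! hpos
    have := mul_pos hε hpos
    linarith
  simp only [Finset.univ_unique, Finset.sum_singleton] at hvs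
  have hc0 : 0 < c default := by
    refine lt_of_le_of_ne (hc _) fun h0 => ?_
    rw [← h0, zero_smul] at hvs
    have hx₀s : x₀ ∈ (s : Set E) := by
      rw [← hv s, hvs]
      exact ⟨hx₀P, by simp⟩
    have : (⟨p, hp⟩ : A) ∈ tight w g x₀ := hx₀s.2 (htight ▸ rfl)
    exact hplt.ne this
  have h1 := hx s
  rw [← hh s y hys, hvs, inner_smul_left, inner_smul_left, hyp] at h1
  exact le_of_mul_le_mul_left h1 hc0

/-- The facet normals of a full-dimensional simple polyhedron form a simple description. -/
theorem IsSimplePolyhedron.exists_data {P : Set E} (hP : IsSimplePolyhedron P)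
    {v : facets P → E} (hv : ∀ s : facets P, maxFace P (v s) = (s : Set E)) :
    ∃ h : facets P → ℝ, P = hPoly v h ∧ IsSimpleData v h ∧
      ∀ s : facets P, ∀ x ∈ P, x ∈ (s : Set E) ↔ s ∈ tight v h x := by
  have hfin := hP.1.finite_facets
  choose z hz using fun s : facets P => s.2.2.1
  have hmax : ∀ s, ∀ y ∈ P, inner ℝ (v s) y ≤ inner ℝ (v s) (z s) := fun s => by
    have := hz s
    rw [← hv s] at this
    exact this.2
  let h : facets P → ℝ := fun s => inner ℝ (v s) (z s)
  have hiff : ∀ s : facets P, ∀ x ∈ P, x ∈ (s : Set E) ↔ s ∈ tight v h x := by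
    intro s x hx
    constructor
    · intro hxs
      rw [← hv s] at hxs
      exact le_antisymm (hmax s x hx) (hxs.2 _ (s.2.1.subset (hz s)))
    · intro hxs
      rw [← hv s]
      refine ⟨hx, fun y hy => ?_⟩
      have hxs' : inner ℝ (v s) x = inner ℝ (v s) (z s) := hxs
      rw [hxs']
      exact hmax s y hy
  have hPh : P = hPoly v h := hP.1.eq_hPoly hP.2.1 hv fun s x hx =>
    (hiff s x (s.2.1.subset hx)).1 hx
  refine ⟨h, hPh, ⟨?_, fun x hx => ?_, fun s => ?_⟩, hiff⟩
  · rw [← hPh]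
    exact hP.2.1.mono interior_subset
  · have hxP : x ∈ P := hPh ▸ hx
    have hexp : IsExposed ℝ P (hFace v h (tight v h x)) := by
      have := isExposed_hFace (w := v) (h := h) (tight v h x)
      rwa [← hPh] at this
    have hcount := hP.2.2 _ hexp ⟨x, hx, subset_rfl⟩
    have hset : {G ∈ facets P | hFace v h (tight v h x) ⊆ G} = Subtype.val '' tight v h x := by
      ext G
      constructor
      · rintro ⟨hG, hsub⟩
        exact ⟨⟨G, hG⟩, (hiff ⟨G, hG⟩ x hxP).1 (hsub ⟨hx, subset_rfl⟩), rfl⟩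
      · rintro ⟨s, hs, rfl⟩
        exact ⟨s.2, fun y hy => (hiff s y (hPh ▸ hy.1)).2 (hy.2 hs)⟩
    rw [hset, Subtype.val_injective.encard_image, ← (Set.toFinite _).cast_ncard_eq,
      ← finrank_vectorSpan_hFace hx] at hcount
    -- Simplicity says that the number of tight facets equals the codimension, which is the rank of
    -- their normals; hence the normals are independent.
    have hcard : (tight v h x).ncard =
        Module.finrank ℝ (Submodule.span ℝ (v '' tight v h x)) := by
      have : (tight v h x).ncard + Module.finrank ℝ (vectorSpan ℝ (hFace v h (tight v h x))) =
          Module.finrank ℝ (Submodule.span ℝ (v '' tight v h x)) +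
            Module.finrank ℝ (vectorSpan ℝ (hFace v h (tight v h x))) := by
        exact_mod_cast hcount
      omega
    have := Fintype.ofFinite (tight v h x)
    rw [LinearIndepOn, linearIndependent_iff_card_eq_finrank_span, Set.finrank,
      ← Set.image_eq_range, ← hcard, ← Nat.card_eq_fintype_card, Nat.card_coe_set_eq]
  · have hzP : z s ∈ P := s.2.1.subset (hz s)
    exact ⟨z s, hPh ▸ hzP, rfl⟩

end FacetDescription

/-! ### Truncations at faces -/

section Truncations

variable {E : Type*} [NormedAddCommGroup E] [InnerProductSpace ℝ E] {S : Type*}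
  {Δ : AbstractSimplicialComplex S} {v : S → E} {h : S → ℝ}

/-- `Δ` is the complex of all sets of inequalities of `hPoly v h` with a common tight point. -/
def IsDualOf (Δ : AbstractSimplicialComplex S) (v : S → E) (h : S → ℝ) : Prop :=
  ∀ T : Finset S, (T = ∅ ∨ T ∈ Δ.faces) ↔ (hFace v h (T : Set S)).Nonempty

/-- The maximum of `faceVec v J` on `hPoly v h`. -/
def faceValue (h : S → ℝ) (J : Face Δ) : ℝ := ∑ s ∈ J.1, h s

open scoped Classical in
/-- The maximum of `faceVec v J` on the truncation of `hPoly v h` at the face `I`. -/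
noncomputable def truncValue (h : S → ℝ) (I : Face Δ) (b : ℝ) (J : Face Δ) : ℝ :=
  faceValue h J + if I ≤ J then b - faceValue h I else 0

theorem inner_faceVec (J : Face Δ) (x : E) :
    inner ℝ (faceVec v J) x = ∑ s ∈ J.1, inner ℝ (v s) x := by
  rw [faceVec, sum_inner]

theorem inner_faceVec_le {x : E} (hx : x ∈ hPoly v h) (J : Face Δ) :
    inner ℝ (faceVec v J) x ≤ faceValue h J := by
  rw [inner_faceVec]
  exact Finset.sum_le_sum fun s _ => hx s

theorem inner_faceVec_eq_iff {x : E} (hx : x ∈ hPoly v h) (J : Face Δ) :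
    inner ℝ (faceVec v J) x = faceValue h J ↔ (J.1 : Set S) ⊆ tight v h x := by
  rw [inner_faceVec]
  exact Finset.sum_eq_sum_iff_of_le fun s _ => hx s

/-- When `I ≤ J`, the part of the sum over `I` is bounded by `b` and the rest by the values of `h`.
-/
theorem inner_faceVec_le_truncValue {I : Face Δ} {b : ℝ} {x : E}
    (hx : x ∈ truncation (hPoly v h) (faceVec v I) b) (J : Face Δ) :
    inner ℝ (faceVec v J) x ≤ truncValue h I b J := by
  classical
  rw [truncValue]
  split_ifs with hIJ
  · have h1 := hx.2
    rw [inner_faceVec, faceValue, ← Finset.sum_sdiff hIJ, ← Finset.sum_sdiff hIJ]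
    rw [inner_faceVec] at h1
    have h2 : ∑ s ∈ J.1 \ I.1, inner ℝ (v s) x ≤ ∑ s ∈ J.1 \ I.1, h s :=
      Finset.sum_le_sum fun s _ => hx.1 s
    rw [faceValue]
    linarith
  · rw [add_zero]
    exact inner_faceVec_le hx.1 J

theorem inner_faceVec_eq_truncValue_iff {I : Face Δ} {b : ℝ} {x : E}
    (hx : x ∈ truncation (hPoly v h) (faceVec v I) b) (J : Face Δ) :
    inner ℝ (faceVec v J) x = truncValue h I b J ↔
      (∀ s ∈ J.1, (I ≤ J → s ∉ I.1) → s ∈ tight v h x) ∧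
        (I ≤ J → inner ℝ (faceVec v I) x = b) := by
  classical
  rw [truncValue]
  split_ifs with hIJ
  · have h1 := hx.2
    have h2 : ∀ s ∈ J.1 \ I.1, inner ℝ (v s) x ≤ h s := fun s _ => hx.1 s
    have h3 := Finset.sum_le_sum h2
    have h4 := Finset.sum_eq_sum_iff_of_le h2
    have h5 : inner ℝ (faceVec v J) x =
        ∑ s ∈ J.1 \ I.1, inner ℝ (v s) x + inner ℝ (faceVec v I) x := by
      rw [inner_faceVec, inner_faceVec]
      exact (Finset.sum_sdiff hIJ).symm
    have h6 : faceValue h J = ∑ s ∈ J.1 \ I.1, h s + faceValue h I :=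
      (Finset.sum_sdiff hIJ).symm
    rw [h5, h6]
    have h7 : (∀ s ∈ J.1, (I ≤ J → s ∉ I.1) → s ∈ tight v h x) ↔
        ∑ s ∈ J.1 \ I.1, inner ℝ (v s) x = ∑ s ∈ J.1 \ I.1, h s := by
      rw [h4]
      simp only [Finset.mem_sdiff, and_imp, hIJ, true_imp_iff]
      exact Iff.rfl
    rw [h7]
    constructor
    · intro h8
      exact ⟨by linarith, fun _ => by linarith⟩
    · rintro ⟨h8, h9⟩
      linarith [h9 hIJ]
  · rw [add_zero, inner_faceVec_eq_iff hx.1]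
    simp only [hIJ, false_imp_iff, true_imp_iff, and_true]
    exact Iff.rfl

/-- The combinatorial content of truncating `hPoly v h` at the face `I`. -/
structure IsTruncation (v : S → E) (h : S → ℝ) (I : Face Δ) (b : ℝ) : Prop where
  lt_inner : ∀ x ∈ hFace v h (I.1 : Set S), b < inner ℝ (faceVec v I) x
  exists_eq : ∀ T : Set S, (hFace v h (T ∪ I.1)).Nonempty → ¬ (I.1 : Set S) ⊆ T →
    ∃ x ∈ hFace v h T, inner ℝ (faceVec v I) x = b
  inner_lt : ∀ T : Set S, ¬ (hFace v h (T ∪ I.1)).Nonempty →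
    ∀ x ∈ hFace v h T, inner ℝ (faceVec v I) x < b

theorem hFace_inter (T U : Set S) : hFace v h T ∩ hFace v h U = hFace v h (T ∪ U) := by
  ext x
  exact ⟨fun hx => ⟨hx.1.1, Set.union_subset hx.1.2 hx.2.2⟩, fun hx =>
    ⟨⟨hx.1, Set.subset_union_left.trans hx.2⟩, hx.1, Set.subset_union_right.trans hx.2⟩⟩

theorem hFace_anti {T U : Set S} (hTU : T ⊆ U) : hFace v h U ⊆ hFace v h T := fun _ hx =>
  ⟨hx.1, hTU.trans hx.2⟩

theorem IsDualOf.hFace_nonempty (hΔ : IsDualOf Δ v h) (X : Face Δ) {T : Set S}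
    (hT : T ⊆ X.1) : (hFace v h T).Nonempty :=
  ((hΔ X.1).1 X.2).mono (hFace_anti hT)

theorem IsDualOf.exists_face [Finite S] (hΔ : IsDualOf Δ v h) {T : Set S}
    (hT : (hFace v h T).Nonempty) : ∃ X : Face Δ, ∀ s, s ∈ X.1 ↔ s ∈ T := by
  refine ⟨⟨T.toFinite.toFinset, (hΔ _).2 (by simpa using hT)⟩, fun s => ?_⟩
  simp

theorem Truncates.isTruncation [FiniteDimensional ℝ E] [Finite S]
    (hs : IsSimpleData v h) {I : Face Δ} {b : ℝ}
    (ht : Truncates (hPoly v h) (hFace v h (I.1 : Set S)) (faceVec v I) b) :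
    IsTruncation v h I b := by
  refine ⟨ht.1, fun T hT hIT => ?_, fun T hT => ?_⟩
  · refine ht.2.1 _ (isExposed_hFace T) (by rwa [hFace_inter]) fun hsub => hIT ?_
    obtain ⟨x, hx⟩ := hT
    -- A point whose tight set is exactly `T` turns inclusion of faces into inclusion of index sets.
    obtain ⟨y, hy, hyT⟩ := exists_tight_eq hs.indep hx.1 (Set.subset_union_left.trans hx.2)
    exact hyT ▸ (hsub ⟨hy, hyT.ge⟩).2
  · refine ht.2.2 _ (isExposed_hFace T) ?_
    rwa [hFace_inter, ← Set.not_nonempty_iff_eq_empty]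

open Filter Topology in
-- Any `b` slightly below the maximum `H` works: of the finitely many faces, those disjoint from the
-- truncated one have a maximum below `H`, and those not inside it have a point of value below `H`.
-- The intermediate value theorem then gives a point at level `b`.
theorem exists_truncates [FiniteDimensional ℝ E] [Finite S] (I : Face Δ) :
    ∃ b, Truncates (hPoly v h) (hFace v h (I.1 : Set S)) (faceVec v I) b := by
  let H := faceValue h I
  have hlt : ∀ x ∈ hPoly v h, x ∉ hFace v h (I.1 : Set S) → inner ℝ (faceVec v I) x < H :=
    fun x hx hxI => lt_of_le_of_ne (inner_faceVec_le hx I) fun heq =>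
      hxI ⟨hx, (inner_faceVec_eq_iff hx I).1 heq⟩
  have hev : ∀ᶠ b in 𝓝[<] H, ∀ G ∈ {G | IsExposed ℝ (hPoly v h) G ∧ G.Nonempty},
      (G ∩ hFace v h (I.1 : Set S) = ∅ → ∀ x ∈ G, inner ℝ (faceVec v I) x < b) ∧
      (¬ G ⊆ hFace v h (I.1 : Set S) → ∃ x ∈ G, inner ℝ (faceVec v I) x ≤ b) := by
    rw [eventually_all_finite (finite_exposed_hPoly v h)]
    rintro G ⟨hG, hne⟩
    refine Eventually.and ?_ ?_
    · by_cases hd : G ∩ hFace v h (I.1 : Set S) = ∅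
      · obtain ⟨x, -, hGx⟩ := exists_eq_hFace_of_isExposed hG hne
        obtain ⟨z, hz, hmax⟩ := IsPolyhedron.exists_isMax (hGx ▸ isPolyhedron_hFace _) hne
          (faceVec v I) fun y hy => inner_faceVec_le (hG.subset hy) I
        have hzH := hlt z (hG.subset hz) fun hzI => (hd ▸ (⟨hz, hzI⟩ : z ∈ G ∩ _) : z ∈ (∅ : Set E))
        filter_upwards [Ioo_mem_nhdsLT hzH] with b hb _ x hx
        exact (hmax x hx).trans_lt hb.1
      · exact Eventually.of_forall fun _ h => absurd h hd
    · by_cases hsub : G ⊆ hFace v h (I.1 : Set S)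
      · exact Eventually.of_forall fun _ h => absurd hsub h
      · obtain ⟨x, hx, hxI⟩ := Set.not_subset.1 hsub
        filter_upwards [Ioo_mem_nhdsLT (hlt x (hG.subset hx) hxI)] with b hb _
        exact ⟨x, hx, hb.1.le⟩
  obtain ⟨b, hb, hbH⟩ := (hev.and self_mem_nhdsWithin).exists
  have hbH : b < H := hbH
  have hI : ∀ x ∈ hFace v h (I.1 : Set S), b < inner ℝ (faceVec v I) x := fun x hx => by
    rw [(inner_faceVec_eq_iff hx.1 I).2 hx.2]
    exact hbH
  refine ⟨b, hI, fun G hG hmeet hsub => ?_, fun G hG hd x hx => (hb G ⟨hG, x, hx⟩).1 hd x hx⟩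
  obtain ⟨x, hxG, hxI⟩ := hmeet
  obtain ⟨y, hyG, hy⟩ := (hb G ⟨hG, x, hxG⟩).2 hsub
  have hpre : IsPreconnected G := (hG.convex convex_hPoly).isPreconnected
  obtain ⟨z, hz, hzb⟩ := hpre.intermediate_value hyG hxG
    (f := fun x => inner ℝ (faceVec v I) x) (by fun_prop) ⟨hy, (hI x hxI).le⟩
  exact ⟨z, hz, hzb⟩

variable {B N : Set (Face Δ)} {I : Face Δ} {b : ℝ}

/-- The tight set of a point of a truncation, as a face. -/
theorem IsTruncation.exists_face [Finite S] (ht : IsTruncation v h I b) (hΔ : IsDualOf Δ v h)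
    {x : E} (hx : x ∈ truncation (hPoly v h) (faceVec v I) b) :
    ∃ X : Face Δ, tight v h x ⊆ X.1 ∧ (inner ℝ (faceVec v I) x = b → I ≤ X) := by
  by_cases hxb : inner ℝ (faceVec v I) x = b
  · have hne : (hFace v h (tight v h x ∪ I.1)).Nonempty := by
      by_contra hne
      exact (ht.inner_lt _ hne x ⟨hx.1, subset_rfl⟩).ne hxb
    obtain ⟨X, hX⟩ := hΔ.exists_face hne
    exact ⟨X, fun s hs => (hX s).2 (Or.inl hs), fun _ s hs => (hX s).2 (Or.inr hs)⟩
  · obtain ⟨X, hX⟩ := hΔ.exists_face (T := tight v h x) ⟨x, hx.1, subset_rfl⟩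
    exact ⟨X, fun s hs => (hX s).2 hs, fun h => absurd h hxb⟩

/-- The members of a nested set attain their maxima over a truncation simultaneously. -/
theorem IsTruncation.exists_forall_eq [Finite S] (ht : IsTruncation v h I b)
    (hΔ : IsDualOf Δ v h) (hB : IsUnionClosed B) (hN : IsNested B N) (hI : I ∈ B) :
    ∃ x ∈ truncation (hPoly v h) (faceVec v I) b,
      ∀ J ∈ N, inner ℝ (faceVec v J) x = truncValue h I b J := by
  obtain ⟨X, hX⟩ := hN.exists_upper
  -- `T` collects the vertices that must be tight; the special vertex of `I` from `exists_argmin` is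
  -- not among them. If the face of `T` meets that of `I`, it has a point at level `b`. Otherwise it
  -- survives entirely, and no member of `N` contains `I`, since `T ∪ I` would then be a face.
  let T : Set S := {s | ∃ J ∈ N, s ∈ J.1 ∧ (I ≤ J → s ∉ I.1)}
  have hTX : T ⊆ X.1 := fun s ⟨J, hJ, hs, _⟩ => hX J hJ hs
  have hIT : ¬ (I.1 : Set S) ⊆ T := by
    obtain ⟨t, htI, htN⟩ := hB.exists_argmin hN hI
    intro hsub
    obtain ⟨J, hJ, htJ, hIJ⟩ := hsub htI
    exact hIJ (htN J hJ htJ) htI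
  have hkey : ∀ x ∈ truncation (hPoly v h) (faceVec v I) b, x ∈ hFace v h T →
      (∀ J ∈ N, I ≤ J → inner ℝ (faceVec v I) x = b) →
      ∀ J ∈ N, inner ℝ (faceVec v J) x = truncValue h I b J := fun x hx hxT hxb J hJ =>
    (inner_faceVec_eq_truncValue_iff hx J).2 ⟨fun s hs hsI => hxT.2 ⟨J, hJ, hs, hsI⟩, hxb J hJ⟩
  by_cases hne : (hFace v h (T ∪ I.1)).Nonempty
  · obtain ⟨x, hxT, hxb⟩ := ht.exists_eq T hne hIT
    have hx : x ∈ truncation (hPoly v h) (faceVec v I) b := ⟨hxT.1, hxb.le⟩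
    exact ⟨x, hx, hkey x hx hxT fun _ _ _ => hxb⟩
  · obtain ⟨x, hxT⟩ := hΔ.hFace_nonempty X hTX
    have hx : x ∈ truncation (hPoly v h) (faceVec v I) b :=
      ⟨hxT.1, (ht.inner_lt T hne x hxT).le⟩
    refine ⟨x, hx, hkey x hx hxT fun J hJ hIJ => absurd (hΔ.hFace_nonempty X ?_) hne⟩
    exact Set.union_subset hTX fun s hs => hX J hJ (hIJ hs)

theorem truncation_eq_hPoly (I : Face Δ) (b : ℝ) :
    truncation (hPoly v h) (faceVec v I) b =
      hPoly (fun o : Option S => o.elim (faceVec v I) v) fun o => o.elim b h := by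
  ext x
  constructor
  · rintro ⟨h1, h2⟩ (_ | s)
    · exact h2
    · exact h1 s
  · exact fun hx => ⟨fun s => hx (some s), hx none⟩

attribute [local instance] Fintype.ofFinite

/-- A linear functional bounded above on a truncation has coordinates in the cone complex. -/
theorem IsTruncation.exists_coord [FiniteDimensional ℝ E] [Finite S] (ht : IsTruncation v h I b)
    (hΔ : IsDualOf Δ v h) (hne : (truncation (hPoly v h) (faceVec v I) b).Nonempty) {a : E} {β : ℝ}
    (ha : ∀ x ∈ truncation (hPoly v h) (faceVec v I) b, inner ℝ a x ≤ β) :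
    ∃ c, IsCoord Δ c ∧ a = point v c := by
  have hpoly := truncation_eq_hPoly (v := v) (h := h) I b
  obtain ⟨x, hx, hmax⟩ := IsPolyhedron.exists_isMax (hpoly ▸ isPolyhedron_hPoly) hne a ha
  obtain ⟨X, hXt, hXI⟩ := ht.exists_face hΔ hx
  let w : Option S → E := fun o => o.elim (faceVec v I) v
  let g : Option S → ℝ := fun o => o.elim b h
  -- At a maximizer, `a` is a nonnegative combination of tight normals. The normal of the cut is
  -- itself a sum of vectors `v s` with `s ∈ X`.
  obtain ⟨c, hc, hac⟩ := exists_nonneg_combination (fun o : tight w g x => w o) a fun d hd => by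
    obtain ⟨ε, hε, hmem, -⟩ := exists_move (w := w) (h := g) (d := d) (hpoly ▸ hx)
      fun o ho => hd ⟨o, ho⟩
    have := hmax _ (hpoly ▸ hmem)
    rw [inner_add_right, inner_smul_right] at this
    by_contra! hpos
    have := mul_pos hε hpos
    linarith
  have hv : ∀ s ∈ X.1, v s ∈ faceCone v (X.1 : Set S) := fun s hs =>
    Submodule.subset_span ⟨s, hs, rfl⟩
  have hmem : a ∈ faceCone v (X.1 : Set S) := by
    rw [hac]
    refine Submodule.sum_mem _ fun o _ => PointedCone.smul_mem _ (hc o) ?_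
    obtain ⟨_ | s, ho⟩ := o
    · exact Submodule.sum_mem _ fun s hs => hv s (hXI ho hs)
    · exact hv s (hXt ho)
  obtain ⟨e, he, heX, hae⟩ := mem_hull_image_iff.1 hmem
  exact ⟨e, ⟨he, X, heX⟩, hae⟩

/-- A dependency `a` has all coordinates zero, as `v` is independent on a face. For maximal `J` with
`a J ≠ 0`, the coordinate at its special vertex from `exists_argmin` is `a J` alone. -/
theorem linearIndepOn_faceVec [Finite S] (hs : IsSimpleData v h) (hΔ : IsDualOf Δ v h)
    (hB : IsUnionClosed B) (hN : IsNested B N) : LinearIndepOn ℝ (faceVec v) N := by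
  classical
  obtain ⟨X, hX⟩ := hN.exists_upper
  obtain ⟨x, hx⟩ := hΔ.hFace_nonempty X subset_rfl
  have hli : LinearIndepOn ℝ v (X.1 : Set S) := (hs.indep x hx.1).mono hx.2
  rw [LinearIndepOn, Fintype.linearIndependent_iff]
  intro g hg
  let a : Face Δ → ℝ := fun J => if hJ : J ∈ N then g ⟨J, hJ⟩ else 0
  have haN : ∀ J, J ∉ N → a J = 0 := fun J hJ => dif_neg hJ
  have hag : ∀ J : N, a J = g J := fun J => dif_pos J.2
  have hsum : point v (expand a) = 0 := by
    rw [point_expand, ← hg]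
    simp only [← hag]
    refine Eq.trans (Finset.sum_subset (Finset.subset_univ (Finset.univ.filter (· ∈ N)))
      fun J _ hJ => ?_).symm (Finset.sum_subtype _ (by simp) fun J => a J • faceVec v J)
    rw [haN J (by simpa using hJ), zero_smul]
  have hexp0 : ∀ s, s ∉ X.1 → expand a s = 0 := fun s hs => by
    refine Finset.sum_eq_zero fun J _ => ?_
    split_ifs with hsJ
    · exact haN J fun hJ => hs (hX J hJ hsJ)
    · rfl
  have hexp : ∀ s ∈ X.1, expand a s = 0 := by
    refine (linearIndepOn_finset_iff.1 hli) (expand a) ?_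
    rw [← hsum, point]
    exact Finset.sum_subset (Finset.subset_univ _) fun s _ hs => by rw [hexp0 s hs, zero_smul]
  by_contra! hcon
  obtain ⟨J₀, hJ₀⟩ := hcon
  obtain ⟨J, -, hJ⟩ := (Set.toFinite {J | a J ≠ 0}).exists_le_maximal (a := J₀.1)
    (by rwa [← hag] at hJ₀)
  have hJN : J ∈ N := by
    by_contra h
    exact hJ.1 (haN J h)
  obtain ⟨t, htJ, htN⟩ := hB.exists_argmin hN (hN.1 hJN)
  have h0 := hexp t (hX J hJN htJ)
  rw [expand, Finset.sum_eq_single J, if_pos htJ] at h0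
  · exact hJ.1 h0
  · intro L _ hLJ
    split_ifs with htL
    · by_contra hL
      have hLN : L ∈ N := by
        by_contra h
        exact hL (haN L h)
      have hle := htN L hLN htL
      exact hLJ (le_antisymm (hJ.2 hL hle) hle)
    · rfl
  · simp

end Truncations

/-! ### The Minkowski sum of the truncations -/

section MinkowskiSum

attribute [local instance] Fintype.ofFinite

variable {E : Type*} [NormedAddCommGroup E] [InnerProductSpace ℝ E] {S : Type*}
  {Δ : AbstractSimplicialComplex S} {v : S → E} {h : S → ℝ} {B : Finset (Face Δ)}
  {b : Face Δ → ℝ}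

/-- The Minkowski sum of the truncations of `hPoly v h` at the faces in `B`. -/
def truncationSum (v : S → E) (h : S → ℝ) (B : Finset (Face Δ)) (b : Face Δ → ℝ) : Set E :=
  ∑ I ∈ B, truncation (hPoly v h) (faceVec v I) (b I)

/-- The maximum of `faceVec v J` on the Minkowski sum of truncations. -/
noncomputable def sumValue (h : S → ℝ) (B : Finset (Face Δ)) (b : Face Δ → ℝ) (J : Face Δ) : ℝ :=
  ∑ I ∈ B, truncValue h I (b I) J

theorem mem_truncationSum {x : E} :
    x ∈ truncationSum v h B b ↔ ∃ y : Face Δ → E,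
      (∀ I ∈ B, y I ∈ truncation (hPoly v h) (faceVec v I) (b I)) ∧ ∑ I ∈ B, y I = x := by
  rw [truncationSum, Set.mem_finsetSum]
  exact ⟨fun ⟨y, hy, hx⟩ => ⟨y, fun I hI => hy hI, hx⟩,
    fun ⟨y, hy, hx⟩ => ⟨y, fun {I} hI => hy I hI, hx⟩⟩

theorem inner_le_sumValue {x : E} (hx : x ∈ truncationSum v h B b) (J : Face Δ) :
    inner ℝ (faceVec v J) x ≤ sumValue h B b J := by
  obtain ⟨y, hy, rfl⟩ := mem_truncationSum.1 hx
  rw [inner_sum]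
  exact Finset.sum_le_sum fun I hI => inner_faceVec_le_truncValue (hy I hI) J

theorem isNested_empty (B : Set (Face Δ)) : IsNested B ∅ :=
  ⟨Set.empty_subset _, fun A hA _ hnt => by
    obtain ⟨J, hJ⟩ := hnt.nonempty
    exact absurd (hA hJ) (Set.notMem_empty J)⟩

variable [Finite S]

theorem exists_mem_truncationSum (hB : IsUnionClosed (B : Set (Face Δ))) (hΔ : IsDualOf Δ v h)
    (ht : ∀ I ∈ B, IsTruncation v h I (b I)) {N : Set (Face Δ)}
    (hN : IsNested (B : Set (Face Δ)) N) :
    ∃ x ∈ truncationSum v h B b, ∀ J ∈ N, inner ℝ (faceVec v J) x = sumValue h B b J := by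
  have hex : ∀ I, ∃ x, I ∈ B → x ∈ truncation (hPoly v h) (faceVec v I) (b I) ∧
      ∀ J ∈ N, inner ℝ (faceVec v J) x = truncValue h I (b I) J := fun I => by
    by_cases hI : I ∈ B
    · obtain ⟨x, hx⟩ := (ht I hI).exists_forall_eq hΔ hB hN hI
      exact ⟨x, fun _ => hx⟩
    · exact ⟨0, fun h => absurd h hI⟩
  choose y hy using hex
  refine ⟨_, mem_truncationSum.2 ⟨y, fun I hI => (hy I hI).1, rfl⟩, fun J hJ => ?_⟩
  rw [inner_sum]
  exact Finset.sum_congr rfl fun I hI => (hy I hI).2 J hJ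

/-- Tightness on the sum forces tightness on every summand. For a join `z ∈ B` of an antichain, no
member contains `z`, so on the summand of `z` all vertices of `z` are tight; but that face was cut
off. -/
theorem isNested_tight [Nonempty S] (hB : IsUnionClosed (B : Set (Face Δ)))
    (hΔ : IsDualOf Δ v h) (ht : ∀ I ∈ B, IsTruncation v h I (b I)) {x : E}
    (hx : x ∈ truncationSum v h B b) :
    IsNested (B : Set (Face Δ)) {J | J ∈ B ∧ inner ℝ (faceVec v J) x = sumValue h B b J} := by
  obtain ⟨y, hy, rfl⟩ := mem_truncationSum.1 hx
  have heq : ∀ J, inner ℝ (faceVec v J) (∑ I ∈ B, y I) = sumValue h B b J → ∀ I ∈ B,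
      (∀ s ∈ J.1, (I ≤ J → s ∉ I.1) → s ∈ tight v h (y I)) ∧
        (I ≤ J → inner ℝ (faceVec v I) (y I) = b I) := by
    intro J hJ I hI
    rw [inner_sum, sumValue] at hJ
    exact (inner_faceVec_eq_truncValue_iff (hy I hI) J).1 ((Finset.sum_eq_sum_iff_of_le
      fun I hI => inner_faceVec_le_truncValue (hy I hI) J).1 hJ I hI)
  refine ⟨fun J hJ => hJ.1, fun A hA hanti hnt => ?_⟩
  obtain ⟨s⟩ := ‹Nonempty S›
  have hI₀ : Face.single Δ s ∈ B := hB.single_mem s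
  -- Any one summand shows that the union is a face; the singleton of `s` is merely an available
  -- member of `B`.
  obtain ⟨X, hXt, hXI⟩ := (ht _ hI₀).exists_face hΔ (hy _ hI₀)
  obtain ⟨z, hz, -⟩ := Face.exists_isLUB (A := A) (X := X) fun J hJ t htJ => by
    obtain ⟨h1, h2⟩ := heq J (hA hJ).2 _ hI₀
    by_cases htI : Face.single Δ s ≤ J ∧ t ∈ (Face.single Δ s).1
    · exact hXI (h2 htI.1) htI.2
    · exact hXt (h1 t htJ fun h3 h4 => htI ⟨h3, h4⟩)
  refine ⟨z, hz, fun hzB => ?_⟩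
  have hsub : (z.1 : Set S) ⊆ tight v h (y z) := by
    intro t htz
    obtain ⟨J, hJ, htJ⟩ := (Face.isLUB_iff.1 hz t).1 htz
    refine (heq J (hA hJ).2 z hzB).1 t htJ fun hzJ => ?_
    obtain ⟨L, hL, hLJ⟩ := hnt.exists_ne J
    exact absurd ((hz.1 hL).trans hzJ) (hanti hL hJ hLJ)
  have := (ht z hzB).lt_inner (y z) ⟨(hy z hzB).1, hsub⟩
  exact this.not_ge (hy z hzB).2

variable [FiniteDimensional ℝ E]

theorem isPolyhedron_truncationSum : IsPolyhedron (truncationSum v h B b) := by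
  refine isPolyhedron_iff_isLinPoly.2 (isLinPoly_sum B fun I _ => ?_)
  rw [truncation_eq_hPoly]
  exact isPolyhedron_iff_isLinPoly.1 isPolyhedron_hPoly

/-- The Minkowski sum is described by the inequalities indexed by `B`. -/
theorem truncationSum_eq_hPoly [Nonempty S] (hB : IsUnionClosed (B : Set (Face Δ)))
    (hΔ : IsDualOf Δ v h) (ht : ∀ I ∈ B, IsTruncation v h I (b I)) :
    truncationSum v h B b =
      hPoly (fun J : (B : Set (Face Δ)) => faceVec v (J : Face Δ)) fun J => sumValue h B b J := by
  classical
  refine Set.Subset.antisymm (fun x hx J => inner_le_sumValue hx J) fun x hx => ?_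
  obtain ⟨A, hA⟩ := isPolyhedron_truncationSum (v := v) (h := h) (B := B) (b := b)
  by_contra hxQ
  rw [hA] at hxQ
  simp only [Set.mem_ofPred_eq, not_forall, not_le] at hxQ
  obtain ⟨p, hp, hxp⟩ := hxQ
  have hle : ∀ y ∈ truncationSum v h B b, inner ℝ p.1 y ≤ p.2 := fun y hy => by
    rw [hA] at hy
    exact hy p hp
  obtain ⟨s⟩ := ‹Nonempty S›
  have hI₀ : Face.single Δ s ∈ B := hB.single_mem s
  generalize Face.single Δ s = I₀ at hI₀
  obtain ⟨z, hz, -⟩ := exists_mem_truncationSum hB hΔ ht (isNested_empty _)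
  obtain ⟨y, hy, -⟩ := mem_truncationSum.1 hz
  -- Fixing the other summands, a bound on the sum becomes a bound on one truncation, so `p.1` has
  -- coordinates in the cone complex and is a nonnegative combination over a nested set. The point
  -- `q` below maximizes all its terms at once.
  have hbound : ∀ u ∈ truncation (hPoly v h) (faceVec v I₀) (b I₀),
      inner ℝ p.1 u ≤ p.2 - inner ℝ p.1 (∑ I ∈ B.erase I₀, y I) := by
    intro u hu
    have hmem : ∑ I ∈ B, Function.update y I₀ u I ∈ truncationSum v h B b := by
      refine mem_truncationSum.2 ⟨Function.update y I₀ u, fun I hI => ?_, rfl⟩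
      by_cases hII : I = I₀
      · subst hII
        rwa [Function.update_self]
      · rw [Function.update_of_ne hII]
        exact hy I hI
    have := hle _ hmem
    rw [← Finset.add_sum_erase _ _ hI₀, Function.update_self, inner_add_right,
      Finset.sum_congr rfl fun I hI => Function.update_of_ne (Finset.ne_of_mem_erase hI) _ _] at this
    linarith
  obtain ⟨c, hc, hpc⟩ := (ht I₀ hI₀).exists_coord hΔ ⟨_, hy I₀ hI₀⟩ hbound
  obtain ⟨a, ha, rfl⟩ := hB.exists_expand hc
  rw [point_expand] at hpc
  obtain ⟨q, hq, hqN⟩ := exists_mem_truncationSum hB hΔ ht ha.nested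
  have hxq : inner ℝ p.1 x ≤ inner ℝ p.1 q := by
    rw [hpc, sum_inner, sum_inner]
    refine Finset.sum_le_sum fun J _ => ?_
    rw [inner_smul_left, inner_smul_left]
    rcases (ha.nonneg J).eq_or_lt with h0 | hpos
    · simp [← h0]
    · refine mul_le_mul_of_nonneg_left ?_ hpos.le
      rw [hqN J hpos]
      exact hx ⟨J, ha.nested.1 hpos⟩
  exact (hxp.trans_le hxq).not_ge (hle q hq)

theorem isSimpleData_sum [Nonempty S] (hs : IsSimpleData v h)
    (hB : IsUnionClosed (B : Set (Face Δ))) (hΔ : IsDualOf Δ v h)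
    (ht : ∀ I ∈ B, IsTruncation v h I (b I)) :
    IsSimpleData (fun J : (B : Set (Face Δ)) => faceVec v (J : Face Δ)) fun J => sumValue h B b J := by
  have heq := truncationSum_eq_hPoly hB hΔ ht
  refine ⟨?_, fun x hx => ?_, fun J => ?_⟩
  · obtain ⟨x, hx, -⟩ := exists_mem_truncationSum hB hΔ ht (isNested_empty _)
    exact ⟨x, heq ▸ hx⟩
  · have hN := isNested_tight hB hΔ ht (heq ▸ hx)
    have hli := linearIndepOn_faceVec hs hΔ hB hN
    let f : tight (fun J : (B : Set (Face Δ)) => faceVec v (J : Face Δ))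
        (fun J => sumValue h B b J) x →
        {J | J ∈ B ∧ inner ℝ (faceVec v J) x = sumValue h B b J} :=
      fun J => ⟨J.1.1, J.1.2, J.2⟩
    have hf : Function.Injective f := fun J J' hJJ' => by
      have hval : (f J).1 = (f J').1 := congrArg Subtype.val hJJ'
      exact Subtype.ext (Subtype.ext hval)
    exact LinearIndependent.comp hli f hf
  · obtain ⟨x, hx, hJ⟩ := exists_mem_truncationSum hB hΔ ht (isNested_singleton J.2)
    exact ⟨x, heq ▸ hx, hJ J rfl⟩

theorem isNestohedron_truncationSum [Nonempty S] (hs : IsSimpleData v h)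
    (hB : IsUnionClosed (B : Set (Face Δ))) (hΔ : IsDualOf Δ v h)
    (ht : ∀ I ∈ B, IsTruncation v h I (b I)) :
    IsNestohedron (B : Set (Face Δ)) (truncationSum v h B b) := by
  have heq := truncationSum_eq_hPoly hB hΔ ht
  have hd := isSimpleData_sum hs hB hΔ ht
  rw [heq]
  refine ⟨hd.isSimplePolyhedron, hd.facetEquiv, fun N => ?_⟩
  change (N.Nonempty ∧ IsNested _ _) ↔ _ ∧ _
  rw [Finset.map_nonempty]
  refine and_congr_right fun _ => ⟨fun hN => ?_, ?_⟩
  · obtain ⟨x, hx, hxN⟩ := exists_mem_truncationSum hB hΔ ht hN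
    have hx' := heq ▸ hx
    refine ⟨x, hx', fun F hF => ?_⟩
    obtain ⟨J, hJ, rfl⟩ := Finset.mem_map.1 hF
    exact (hd.mem_facetEquiv hx' J).2 (hxN J ⟨J, hJ, rfl⟩)
  · rintro ⟨x, hx, hxN⟩
    refine (isNested_tight hB hΔ ht (heq ▸ hx)).mono ?_
    rintro _ ⟨J, hJ, rfl⟩
    exact ⟨J.2, (hd.mem_facetEquiv hx J).1 (hxN _ (Finset.mem_map_of_mem _ hJ))⟩

end MinkowskiSum

/-! ### Transfer to simple polyhedra and their dual complexes -/

section SimplePolyhedra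

variable {E : Type*} [NormedAddCommGroup E] [InnerProductSpace ℝ E]

theorem facetInter_eq_hFace {P : Set E} {v : facets P → E} {h : facets P → ℝ}
    (hP : P = hPoly v h) (hmem : ∀ s : facets P, ∀ x ∈ P, x ∈ (s : Set E) ↔ s ∈ tight v h x)
    (T : Finset (facets P)) : facetInter P T = hFace v h (T : Set (facets P)) := by
  ext x
  constructor
  · exact fun hx => ⟨hP ▸ hx.1, fun s hs => (hmem s x hx.1).1 (hx.2 s hs)⟩
  · intro hx
    have hxP : x ∈ P := hP ▸ hx.1
    exact ⟨hxP, fun s hs => (hmem s x hxP).2 (hx.2 hs)⟩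

theorem isDualOf_dualComplex {P : Set E} {v : facets P → E} {h : facets P → ℝ}
    (hP : P = hPoly v h) (hmem : ∀ s : facets P, ∀ x ∈ P, x ∈ (s : Set E) ↔ s ∈ tight v h x)
    (hne : P.Nonempty) : IsDualOf (dualComplex P) v h := by
  intro T
  rw [← facetInter_eq_hFace hP hmem]
  constructor
  · rintro (rfl | hT)
    · obtain ⟨x, hx⟩ := hne
      exact ⟨x, hx, by simp⟩
    · exact hT.2
  · intro hT
    exact T.eq_empty_or_nonempty.imp_right fun hT0 => ⟨hT0, hT⟩

end SimplePolyhedra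

end NestedFan

theorem mainTheorem10 :
    (∀ {S : Type*} [Finite S] {E : Type*} [AddCommGroup E] [Module ℝ E]
      (Δ : AbstractSimplicialComplex S) (v : S → E), NonDegenerate Δ v →
      ∀ B : Set (Face Δ), IsBuildingSet B →
        IsFan (nestedFan v B) ∧
        (Nonempty S →
          nestedFan v B =
            coarsestCommonRefinement (fun I : B => nestedFan v (singleFaceSet (I : Face Δ)))) ∧
        Coarsens (nestedFan v B) (nestedFan v (maximalBuildingSet Δ))) ∧
    (∀ {E : Type*} [NormedAddCommGroup E] [InnerProductSpace ℝ E] [FiniteDimensional ℝ E]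
      (P : Set E), IsSimplePolyhedron P → (facets P).Nonempty →
      ∀ v : facets P → E, (∀ s : facets P, maxFace P (v s) = (s : Set E)) →
      ∀ B : Finset (Face (dualComplex P)), IsBuildingSet (B : Set (Face (dualComplex P))) →
        (∀ I ∈ B, ∃ b : ℝ, Truncates P (facetInter P I.1) (∑ s ∈ I.1, v s) b) ∧
        ∀ b : Face (dualComplex P) → ℝ,
          (∀ I ∈ B, Truncates P (facetInter P I.1) (∑ s ∈ I.1, v s) (b I)) →
          IsNestohedron (B : Set (Face (dualComplex P)))
            (∑ I ∈ B, truncation P (∑ s ∈ I.1, v s) (b I))) := by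
  constructor
  · intro S _ E _ _ Δ v hv B hB
    have hB' := hB.isUnionClosed
    exact ⟨nestedFan_isFan hv hB', fun _ => nestedFan_eq_coarsestCommonRefinement hv hB',
      nestedFan_coarsens hv hB' isUnionClosed_maximalBuildingSet
        fun I hI h => hB'.bot_notMem (h ▸ hI)⟩
  · intro E _ _ _ P hP hfac v hv B hB
    have hfin : Finite (facets P) := hP.1.finite_facets
    have hne : Nonempty (facets P) := hfac.to_subtype
    have hB' := hB.isUnionClosed
    obtain ⟨h, hPh, hs, hmem⟩ := hP.exists_data hv
    have hΔ := isDualOf_dualComplex hPh hmem (hP.2.1.mono interior_subset)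
    have hiff : ∀ (I : Face (dualComplex P)) (b : ℝ),
        Truncates P (facetInter P I.1) (∑ s ∈ I.1, v s) b ↔
          Truncates (hPoly v h) (hFace v h (I.1 : Set (facets P))) (faceVec v I) b := by
      intro I b
      rw [facetInter_eq_hFace hPh hmem, ← hPh]
      rfl
    refine ⟨fun I _ => ?_, fun b hb => ?_⟩
    · obtain ⟨b, hb⟩ := exists_truncates (v := v) (h := h) I
      exact ⟨b, (hiff I b).2 hb⟩
    · have hsum : ∑ I ∈ B, truncation P (∑ s ∈ I.1, v s) (b I) = truncationSum v h B b := by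
        refine Finset.sum_congr rfl fun I _ => ?_
        rw [← hPh]
        rfl
      rw [hsum]
      exact isNestohedron_truncationSum hs hB' hΔ fun I hI =>
        ((hiff I (b I)).1 (hb I hI)).isTruncation hs
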